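/- Let $0<\alpha<1$ and $0<d\le \pi\alpha/8$. For $\xi\ge 1$ put $$g(\tau)=g_\xi(\tau)=\frac{e^{-\xi\,\log(1+e^{\tau})^{1/\alpha}}}{1+e^{-\tau}}$$ (principal branches), so that $\xi^{-\alpha}=\frac1{\Gamma(\alpha+1)}\int_{-\infty}^{\infty} g(\tau)\,d\tau$, and let $$\|g\|_{\mathcal D_d}=\int_{-\infty}^{\infty}|g(t+id)|\,dt+\int_{-\infty}^{\infty}|g(t-id)|\,dt .$$ For $0<\varepsilon<1$ put $$h=\frac{2\pi d}{\log(\varepsilon^{-1})},\qquad \beta=\cos(2d/\alpha),\qquad N_-=\left\lceil\frac{2\pi d}{h^2}\right\rceil,\qquad N_+=\left\lceil\left(\frac{2\pi d\,h^{-\frac{\alpha+1}{\alpha}}}{\beta}\right)^{\alpha}\right\rceil,\qquad N=N_-+N_++1,$$ $$A_\varepsilon(\xi)=\frac{h}{\Gamma(\alpha+1)}\sum_{j=-N_-}^{N_+} g_\xi(jh).$$ Then $\beta\ge\cos(\pi/4)$, $\|g\|_{\mathcal D_d}<\infty$ for every $\xi\ge1$, and: 1. For every $0<\varepsilon<1$,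 $A_\varepsilon$ is an exponential sum with $N$ terms: there are $w_j,b_j>0$, independent of $\xi$, with $A_\varepsilon(\xi)=\sum_{j=1}^{N}w_je^{-b_j\xi}$ for all $\xi\ge 1$. 2. For every $0<\varepsilon<1$ and every $\xi\ge1$, $$|\xi^{-\alpha}-A_\varepsilon(\xi)|\le\frac{1}{\Gamma(\alpha+1)}\left(\frac{\|g\|_{\mathcal D_d}}{1-\varepsilon}+\frac1h+\frac1{\beta h^{1/\alpha}}\right)\varepsilon .$$ 3. For every $0<\varepsilon<e^{-\pi^2/4}$ and every $\xi\ge1$, $$|\xi^{-\alpha}-A_\varepsilon(\xi)|\le\left(\|g\|_{\mathcal D_d}+\frac1h+\frac1{\beta h^{1/\alpha}}\right)\varepsilon$$ and $$|\xi^{-\alpha}-A_\varepsilon(\xi)|\le 2\left[1+\log 2+\frac{\Gamma(\alpha+1)}{\cos(\pi/8)^{\alpha}}+\cos(\pi/4)^{-1}\left(\frac{4\log(\varepsilon^{-1})}{\pi^2\alpha}\right)^{1/\alpha}\right]\varepsilon .$$ 4. As $\varepsilon\to0^+$ (with $\alpha$, $d$ fixed), $N\sim\dfrac{\log^2(1/\varepsilon)}{2\pi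 d}$ and $\log(1/\varepsilon)\sim\sqrt{2\pi dN}$ (the ratios tend to $1$). More precisely, there is a constant $C>0$, depending only on $\alpha$ and $d$, such that for all $0<\varepsilon<e^{-\pi^2/4}$ $$e^{-\sqrt{2\pi dN}}\le\varepsilon\le e^{-\sqrt{2\pi dN}+CN^{\alpha/2}},\qquad \sup_{\xi\ge1}|\xi^{-\alpha}-A_\varepsilon(\xi)|\le C\,e^{-\sqrt{2\pi dN}+CN^{\alpha/2}} ;$$ since $\alpha<1$, $N^{\alpha/2}$ is of lower order than $\sqrt N$. -/

import Mathlib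

namespace SincExpSum

noncomputable section

/-- The integrand `g(τ) = exp(-ξ log(1 + e^τ)^{1/α}) / (1 + e^{-τ})`, with principal logarithm
and principal power. -/
def g (α ξ : ℝ) (τ : ℂ) : ℂ :=
  Complex.exp (-(Complex.log (1 + Complex.exp τ) ^ ((1 / α : ℝ) : ℂ)) * (ξ : ℂ)) /
    (1 + Complex.exp (-τ))

/-- The function `|f|` is integrable on both boundary lines `Im z = d` and `Im z = -d` of the
strip `D_d`, that is, the boundary norm below is finite. -/
def StripBoundaryIntegrable (d : ℝ) (f : ℂ → ℂ) : Prop :=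
  MeasureTheory.Integrable (fun t : ℝ => f ((t : ℂ) + (d : ℂ) * Complex.I)) ∧
    MeasureTheory.Integrable (fun t : ℝ => f ((t : ℂ) - (d : ℂ) * Complex.I))

/-- `‖f‖_{D_d} = ∫_{∂D_d} |f(z)| |dz|` for the strip `D_d = {z : |Im z| < d}`. -/
def stripNorm (d : ℝ) (f : ℂ → ℂ) : ℝ :=
  (∫ t : ℝ, ‖f ((t : ℂ) + (d : ℂ) * Complex.I)‖) +
    ∫ t : ℝ, ‖f ((t : ℂ) - (d : ℂ) * Complex.I)‖

/-- The truncated sinc quadrature `E_{m,n}(f,h) = h ∑_{j=-m}^{n} f(jh)`. -/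
def truncSinc (m n : ℕ) (f : ℂ → ℂ) (h : ℝ) : ℂ :=
  (h : ℂ) * ∑ j ∈ Finset.Icc (-(m : ℤ)) (n : ℤ), f ((j : ℂ) * (h : ℂ))

/-- The step `h = 2πd / log(1/ε)`. -/
def step (d ε : ℝ) : ℝ := 2 * Real.pi * d / Real.log ε⁻¹

/-- `β = cos(2d/α)`. -/
def beta (α d : ℝ) : ℝ := Real.cos (2 * d / α)

/-- `N_- = 2πd / h²`, rounded up to an integer. -/
def Nminus (d ε : ℝ) : ℕ := ⌈2 * Real.pi * d / step d ε ^ 2⌉₊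

/-- `N_+ = (2πd h^{-(α+1)/α} / β)^α`, rounded up to an integer. -/
def Nplus (α d ε : ℝ) : ℕ :=
  ⌈(2 * Real.pi * d * step d ε ^ (-((α + 1) / α)) / beta α d) ^ α⌉₊

/-- The number `N = N_- + N_+ + 1` of terms. -/
def numTerms (α d ε : ℝ) : ℕ := Nminus d ε + Nplus α d ε + 1

/-- The approximant of `ξ^{-α} = (1/Γ(α+1)) ∫ g(τ) dτ`: the truncated sinc quadrature of the
normalized integrand `g / Γ(α+1)`. -/
def approx (α d ε ξ : ℝ) : ℂ :=
  truncSinc (Nminus d ε) (Nplus α d ε) (fun τ => g α ξ τ / (Real.Gamma (α + 1) : ℂ)) (step d ε)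

/-- The approximation error at `ξ`. -/
def err (α d ε ξ : ℝ) : ℝ := ‖((ξ ^ (-α) : ℝ) : ℂ) - approx α d ε ξ‖

end

end SincExpSum

/-!
Poisson summation together with a shift of the Fourier integrals of `g` to the lines `Im z = ±d`
bounds the discretization error of the trapezoidal sum by `‖g‖_{D_d} / (e^{2πd/h} - 1)`, and the
choice of `h` makes `e^{-2πd/h}` equal to `ε`. On the real line `g` is
`s' exp (-ξ s ^ (1 / α))` with `s = log (1 + e^t)`; it is at most `e^t`, and at most
`exp (-ξ t ^ (1 / α))` for `t ≥ 0`. The tangent to the convex function `t ^ (1 / α)` at the cut-off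
therefore turns both truncation errors into geometric series. On the strip,
`|arg (log (1 + e^z))| ≤ |Im z|`, so `log (1 + e^z) ^ (1 / α)` stays in a sector of half-angle
`d / α` about the positive axis, where its real part dominates `s ^ (1 / α)`.
-/

namespace SincExpSum

open MeasureTheory Filter Topology Complex Asymptotics
open scoped FourierTransform ComplexConjugate

theorem sum_Icc_neg_eq_add {M : Type*} [AddCommMonoid M] (f : ℤ → M) (m n : ℕ) :
    ∑ j ∈ Finset.Icc (-(m : ℤ)) n, f j =
      ∑ k ∈ Finset.range (n + 1), f k + ∑ k ∈ Finset.range m, f (-(k + 1)) := by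
  have union_eq : Finset.Icc (-(m : ℤ)) n = (Finset.range (n + 1)).image (fun k : ℕ => (k : ℤ)) ∪
      (Finset.range m).image fun k : ℕ => -((k : ℤ) + 1) := by
    ext j
    simp only [Finset.mem_Icc, Finset.mem_union, Finset.mem_image, Finset.mem_range]
    constructor
    · rintro ⟨hl, hr⟩
      obtain hj | hj := le_or_gt 0 j
      · exact Or.inl ⟨j.toNat, by omega, by omega⟩
      · exact Or.inr ⟨(-j - 1).toNat, by omega, by omega⟩
    · rintro (⟨k, hk, rfl⟩ | ⟨k, hk, rfl⟩) <;> omega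
  have disjoint : Disjoint ((Finset.range (n + 1)).image fun k : ℕ => (k : ℤ))
      ((Finset.range m).image fun k : ℕ => -((k : ℤ) + 1)) := by
    simp only [Finset.disjoint_left, Finset.mem_image]
    rintro _ ⟨k, -, rfl⟩ ⟨l, -, hl⟩
    omega
  rw [union_eq, Finset.sum_union disjoint, Finset.sum_image (by simp), Finset.sum_image (by simp)]

section TwoSidedSum

variable {E : Type*} [NormedAddCommGroup E] [CompleteSpace E] {f : ℤ → E} {m n : ℕ} {u v : ℕ → ℝ}

theorem summable_int_of_norm_tails_le (hu : Summable u) (hv : Summable v)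
    (hfu : ∀ k : ℕ, ‖f ((k : ℤ) + (n + 1))‖ ≤ u k)
    (hfv : ∀ k : ℕ, ‖f (-((k : ℤ) + m + 1))‖ ≤ v k) : Summable f := by
  refine .of_nat_of_neg_add_one ?_ ?_
  · refine (summable_nat_add_iff (n + 1)).1 (hu.of_norm_bounded fun k => ?_)
    simpa using hfu k
  · refine (summable_nat_add_iff m).1 (hv.of_norm_bounded fun k => ?_)
    simpa using hfv k

theorem norm_tsum_int_sub_sum_Icc_le {U V : ℝ} (hu : HasSum u U) (hv : HasSum v V)
    (hfu : ∀ k : ℕ, ‖f ((k : ℤ) + (n + 1))‖ ≤ u k)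
    (hfv : ∀ k : ℕ, ‖f (-((k : ℤ) + m + 1))‖ ≤ v k) :
    ‖∑' j, f j - ∑ j ∈ Finset.Icc (-(m : ℤ)) n, f j‖ ≤ U + V := by
  have hf := summable_int_of_norm_tails_le hu.summable hv.summable hfu hfv
  have hpos : Summable fun k : ℕ => f k := hf.comp_injective Nat.cast_injective
  have hneg : Summable fun k : ℕ => f (-(k + 1)) :=
    hf.comp_injective fun k l hkl => by simpa using hkl
  have tails_eq : ∑' j, f j - ∑ j ∈ Finset.Icc (-(m : ℤ)) n, f j =
      ∑' k : ℕ, f ((k : ℤ) + (n + 1)) + ∑' k : ℕ, f (-((k : ℤ) + m + 1)) := by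
    rw [tsum_of_nat_of_neg_add_one hpos hneg, sum_Icc_neg_eq_add,
      ← hpos.sum_add_tsum_nat_add (n + 1), ← hneg.sum_add_tsum_nat_add m]
    push_cast
    abel
  rw [tails_eq]
  exact (norm_add_le _ _).trans
    (add_le_add (tsum_of_norm_bounded hu hfu) (tsum_of_norm_bounded hv hfv))

end TwoSidedSum

theorem hasSum_exp_neg_arith {κ : ℝ} (hκ : 0 < κ) (s : ℝ) :
    HasSum (fun k : ℕ => Real.exp (-(s + (k + 1) * κ))) (Real.exp (-s) / (Real.exp κ - 1)) := by
  have term_eq (k : ℕ) :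
      Real.exp (-(s + (k + 1) * κ)) = Real.exp (-(s + κ)) * Real.exp (-κ) ^ k := by
    rw [← Real.exp_nat_mul, ← Real.exp_add]
    ring_nf
  have sum_eq : Real.exp (-s) / (Real.exp κ - 1) =
      Real.exp (-(s + κ)) * (1 - Real.exp (-κ))⁻¹ := by
    have : Real.exp κ - 1 ≠ 0 := (sub_pos.2 (Real.one_lt_exp_iff.2 hκ)).ne'
    rw [neg_add, Real.exp_add, Real.exp_neg κ]
    field_simp
  simp_rw [term_eq, sum_eq]
  exact (hasSum_geometric_of_lt_one (Real.exp_nonneg _)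
    (Real.exp_lt_one_iff.2 (neg_lt_zero.2 hκ))).mul_left _

theorem abs_le_of_mem_uIcc {d s y : ℝ} (hy : |y| ≤ d) (hs : s ∈ Set.uIcc 0 y) : |s| ≤ d := by
  have := Set.abs_sub_left_of_mem_uIcc hs
  simp only [sub_zero] at this
  exact this.trans hy

theorem norm_cexp_line (ω t s : ℝ) :
    ‖exp (-(2 * Real.pi * ω * (t + s * I) * I))‖ = Real.exp (2 * Real.pi * ω * s) := by
  rw [norm_exp]
  congr 1
  simp

/-- `f` is complex differentiable on the closed strip `|Im z| ≤ d`, and dominated there by an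
integrable function `F` of the real part. -/
structure StripDominated (d : ℝ) (f : ℂ → ℂ) (F : ℝ → ℝ) : Prop where
  differentiableAt : ∀ z : ℂ, |z.im| ≤ d → DifferentiableAt ℂ f z
  norm_le : ∀ z : ℂ, |z.im| ≤ d → ‖f z‖ ≤ F z.re
  integrable : Integrable F

namespace StripDominated

variable {f : ℂ → ℂ} {F : ℝ → ℝ} {d y : ℝ}

theorem norm_line_le (hf : StripDominated d f F) (hy : |y| ≤ d) (t : ℝ) :
    ‖f (t + y * I)‖ ≤ F t := by
  simpa using hf.norm_le (t + y * I) (by simpa using hy)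

theorem continuous_line (hf : StripDominated d f F) (hy : |y| ≤ d) :
    Continuous fun t : ℝ => f (t + y * I) :=
  continuous_iff_continuousAt.2 fun t =>
    (hf.differentiableAt (t + y * I) (by simpa using hy)).continuousAt.comp
      (f := fun t : ℝ => (t : ℂ) + y * I) (by fun_prop)

theorem integrable_line (hf : StripDominated d f F) (hy : |y| ≤ d) :
    Integrable fun t : ℝ => f (t + y * I) :=
  hf.integrable.mono' (hf.continuous_line hy).aestronglyMeasurable
    (.of_forall (hf.norm_line_le hy))

theorem stripBoundaryIntegrable (hf : StripDominated d f F) (hd : 0 ≤ d) :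
    StripBoundaryIntegrable d f :=
  ⟨hf.integrable_line (abs_of_nonneg hd).le, by
    simpa [sub_eq_add_neg] using hf.integrable_line (y := -d) (by rw [abs_neg, abs_of_nonneg hd])⟩

theorem stripNorm_le (hf : StripDominated d f F) (hd : 0 ≤ d) :
    stripNorm d f ≤ 2 * ∫ t, F t := by
  obtain ⟨hup, hdown⟩ := hf.stripBoundaryIntegrable hd
  rw [stripNorm, two_mul]
  refine add_le_add (integral_mono hup.norm hf.integrable fun t => ?_)
    (integral_mono hdown.norm hf.integrable fun t => ?_)
  · exact hf.norm_line_le (abs_of_nonneg hd).le t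
  · simpa [sub_eq_add_neg] using
      hf.norm_line_le (y := -d) (by rw [abs_neg, abs_of_nonneg hd]) t

theorem intervalIntegral_sub_line (hf : StripDominated d f F) (hy : |y| ≤ d) (T : ℝ) :
    (∫ x : ℝ in -T..T, f x) - (∫ x : ℝ in -T..T, f (x + y * I)) =
      I • (∫ s : ℝ in 0..y, f ((-T : ℝ) + s * I)) - I • (∫ s : ℝ in 0..y, f (T + s * I)) := by
  have hrect := integral_boundary_rect_eq_zero_of_differentiableOn f (-T : ℝ) (T + y * I) (by
    intro z hz
    refine (hf.differentiableAt z (abs_le_of_mem_uIcc hy ?_)).differentiableWithinAt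
    simpa [mem_reProdIm] using hz.2)
  simp only [ofReal_neg, neg_im, ofReal_im, neg_zero, ofReal_zero, zero_mul, add_zero, neg_re,
    ofReal_re, add_re, mul_re, I_re, mul_zero, I_im, mul_one, sub_self, add_im, mul_im, zero_add,
    smul_eq_mul] at hrect
  simp only [smul_eq_mul]
  push_cast
  linear_combination hrect

theorem norm_verticalIntegral_le (hf : StripDominated d f F) (hy : |y| ≤ d) (T : ℝ) :
    ‖∫ s : ℝ in 0..y, f (T + s * I)‖ ≤ F T * |y| := by
  simpa using intervalIntegral.norm_integral_le_of_norm_le_const (a := 0) (b := y)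
    (f := fun s : ℝ => f (T + s * I)) fun s hs =>
      hf.norm_line_le (abs_le_of_mem_uIcc hy (Set.uIoc_subset_uIcc hs)) T

theorem integral_line_eq (hf : StripDominated d f F) (hF0 : Tendsto F (cocompact ℝ) (𝓝 0))
    (hy : |y| ≤ d) : ∫ t : ℝ, f (t + y * I) = ∫ t : ℝ, f t := by
  have hvert : Tendsto (fun T : ℝ => ∫ s : ℝ in 0..y, f (T + s * I)) (cocompact ℝ) (𝓝 0) :=
    squeeze_zero_norm (hf.norm_verticalIntegral_le hy) (by simpa using hF0.mul_const |y|)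
  have hright := hvert.mono_left atTop_le_cocompact
  have hleft := (hvert.mono_left atBot_le_cocompact).comp tendsto_neg_atTop_atBot
  have hreal : Integrable fun t : ℝ => f t := by
    simpa using hf.integrable_line (y := 0) (by simpa using (abs_nonneg y).trans hy)
  have hlim := (intervalIntegral_tendsto_integral hreal tendsto_neg_atTop_atBot tendsto_id).sub
    (intervalIntegral_tendsto_integral (hf.integrable_line hy) tendsto_neg_atTop_atBot tendsto_id)
  have hlim_zero := ((hleft.const_smul I).sub (hright.const_smul I)).congr fun T =>
    (hf.intervalIntegral_sub_line hy T).symm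
  rw [smul_zero, sub_zero] at hlim_zero
  exact (sub_eq_zero.1 (tendsto_nhds_unique hlim hlim_zero)).symm

theorem exp_mul (hf : StripDominated d f F) (ω : ℝ) :
    StripDominated d (fun z => exp (-(2 * Real.pi * ω * z * I)) * f z)
      fun t => Real.exp (2 * Real.pi * |ω| * d) * F t where
  differentiableAt z hz := by
    have := hf.differentiableAt z hz
    fun_prop
  norm_le z hz := by
    have hexp := norm_cexp_line ω z.re z.im
    rw [re_add_im] at hexp
    rw [norm_mul, hexp]
    refine mul_le_mul (Real.exp_le_exp.2 ?_) (hf.norm_le z hz) (norm_nonneg _) (Real.exp_nonneg _)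
    rw [mul_assoc, mul_assoc _ |ω|]
    refine mul_le_mul_of_nonneg_left ((le_abs_self _).trans ?_) Real.two_pi_pos.le
    rw [abs_mul]
    gcongr
  integrable := hf.integrable.const_mul _

theorem norm_fourier_le (hf : StripDominated d f F) (hF0 : Tendsto F (cocompact ℝ) (𝓝 0))
    (hy : |y| ≤ d) (ω : ℝ) :
    ‖𝓕 (fun t : ℝ => f t) ω‖ ≤ Real.exp (2 * Real.pi * ω * y) * ∫ t : ℝ, ‖f (t + y * I)‖ := by
  have fourier_eq : 𝓕 (fun t : ℝ => f t) ω =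
      ∫ t : ℝ, exp (-(2 * Real.pi * ω * t * I)) * f t := by
    rw [Real.fourier_real_eq_integral_exp_smul]
    congr 1 with t
    rw [smul_eq_mul]
    push_cast
    ring_nf
  rw [fourier_eq,
    ← (hf.exp_mul ω).integral_line_eq (by simpa using hF0.const_mul _) hy]
  refine (norm_integral_le_integral_norm _).trans_eq ?_
  simp_rw [norm_mul, norm_cexp_line]
  rw [integral_const_mul]

end StripDominated

section Poisson

variable {h : ℝ}

theorem smul_fourier_comp_mul_right {E : Type*} [NormedAddCommGroup E] [NormedSpace ℂ E]
    (φ : ℝ → E) (hh : 0 < h) (ω : ℝ) : h • 𝓕 (fun t => φ (t * h)) ω = 𝓕 φ (ω / h) := by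
  have hsubst := Measure.integral_comp_mul_right
    (fun t : ℝ => exp ((-2 * Real.pi * t * (ω / h) : ℝ) * I) • φ t) h
  rw [abs_of_pos (inv_pos.2 hh)] at hsubst
  rw [Real.fourier_real_eq_integral_exp_smul, Real.fourier_real_eq_integral_exp_smul,
    ← smul_inv_smul₀ hh.ne' (∫ t : ℝ, _ • φ t), ← hsubst]
  congr! 6 with t
  field_simp

theorem isBigO_comp_mul_right {E : Type*} [NormedAddCommGroup E] {φ : ℝ → E} {b : ℝ} (hh : 0 < h)
    (hφ : φ =O[cocompact ℝ] fun t => |t| ^ b) :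
    (fun t => φ (t * h)) =O[cocompact ℝ] fun t => |t| ^ b := by
  have hmul : Tendsto (fun t : ℝ => t * h) (cocompact ℝ) (cocompact ℝ) :=
    (Homeomorph.mulRight₀ h hh.ne').isClosedEmbedding.tendsto_cocompact
  refine (hφ.comp_tendsto hmul).trans (.of_bound (h ^ b) (.of_forall fun t => ?_))
  rw [Function.comp_apply, abs_mul, abs_of_pos hh, Real.mul_rpow (abs_nonneg _) hh.le, norm_mul,
    mul_comm, Real.norm_of_nonneg (Real.rpow_nonneg hh.le _)]

theorem smul_tsum_eq_tsum_fourier_div {φ : ℝ → ℂ} {b : ℝ} (hh : 0 < h) (hφc : Continuous φ)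
    (hb : 1 < b) (hφ : φ =O[cocompact ℝ] fun t => |t| ^ (-b))
    (hsum : Summable fun n : ℤ => 𝓕 φ (n / h)) :
    h • ∑' j : ℤ, φ (j * h) = ∑' n : ℤ, 𝓕 φ (n / h) := by
  simp_rw [← smul_fourier_comp_mul_right φ hh] at hsum ⊢
  rw [tsum_const_smul'' h]
  congr 1
  simpa using Real.tsum_eq_tsum_fourier_of_rpow_decay_of_summable
    (show Continuous fun t => φ (t * h) by fun_prop) hb (isBigO_comp_mul_right hh hφ)
    (by simpa only [inv_smul_smul₀ hh.ne'] using hsum.const_smul h⁻¹) 0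

end Poisson

namespace StripDominated

variable {f : ℂ → ℂ} {F : ℝ → ℝ} {b d h : ℝ}

theorem norm_integral_sub_trapezoidal_le (hf : StripDominated d f F) (hd : 0 < d) (hh : 0 < h)
    (hb : 1 < b) (hFO : F =O[cocompact ℝ] fun t => |t| ^ (-b)) :
    ‖(∫ t : ℝ, f t) - h * ∑' j : ℤ, f (j * h)‖ ≤
      stripNorm d f / (Real.exp (2 * Real.pi * d / h) - 1) := by
  set κ := 2 * Real.pi * d / h
  have hκ : 0 < κ := by positivity
  have hF0 : Tendsto F (cocompact ℝ) (𝓝 0) := hFO.trans_tendsto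
    ((tendsto_rpow_neg_atTop (zero_lt_one.trans hb)).comp tendsto_norm_cocompact_atTop)
  have hfO : (fun t : ℝ => f t) =O[cocompact ℝ] fun t => |t| ^ (-b) :=
    (IsBigO.of_norm_le fun t => by simpa using hf.norm_le t (by simpa using hd.le)).trans hFO
  have hfc : Continuous fun t : ℝ => f t := by
    simpa using hf.continuous_line (y := 0) (by simpa using hd.le)
  let coeff (n : ℤ) : ℂ := 𝓕 (fun t : ℝ => f t) (n / h)
  have hpos (k : ℕ) : ‖coeff ((k : ℤ) + ((0 : ℕ) + 1))‖ ≤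
      Real.exp (-(0 + (k + 1) * κ)) * ∫ t : ℝ, ‖f (t - d * I)‖ := by
    convert hf.norm_fourier_le hF0 (y := -d) (by rw [abs_neg, abs_of_pos hd]) _ using 3
    · push_cast
      ring
    · simp [sub_eq_add_neg]
  have hneg (k : ℕ) : ‖coeff (-((k : ℤ) + (0 : ℕ) + 1))‖ ≤
      Real.exp (-(0 + (k + 1) * κ)) * ∫ t : ℝ, ‖f (t + d * I)‖ := by
    convert hf.norm_fourier_le hF0 (y := d) (abs_of_pos hd).le _ using 3
    push_cast
    ring
  have hgeom := hasSum_exp_neg_arith hκ 0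
  have aliasing_le := norm_tsum_int_sub_sum_Icc_le (hgeom.mul_right _) (hgeom.mul_right _) hpos hneg
  have hsum := summable_int_of_norm_tails_le (hgeom.mul_right _).summable
    (hgeom.mul_right _).summable hpos hneg
  have poisson := smul_tsum_eq_tsum_fourier_div hh hfc hb hfO hsum
  have zero_freq : ∑ n ∈ Finset.Icc (-((0 : ℕ) : ℤ)) (0 : ℕ), coeff n = ∫ t : ℝ, f t := by
    simp [coeff, Real.fourier_real_eq_integral_exp_smul]
  rw [zero_freq, ← poisson, norm_sub_rev] at aliasing_le
  refine (le_of_eq ?_).trans (aliasing_le.trans_eq ?_)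
  · simp
  · rw [stripNorm, neg_zero, Real.exp_zero]
    ring

end StripDominated

/-- The function `log (1 + e^t)`, the substitution that turns `∫ exp (-c x^{1/α})` over `(0, ∞)`
into the integral of `gReal α c` over the real line. -/
noncomputable def softplus (t : ℝ) : ℝ := Real.log (1 + Real.exp t)

/-- The restriction of `g α c` to the real line. With a smaller `c` it also dominates `g` on a
strip. -/
noncomputable def gReal (α c t : ℝ) : ℝ :=
  Real.sigmoid t * Real.exp (-c * softplus t ^ (1 / α))

theorem softplus_pos (t : ℝ) : 0 < softplus t :=
  Real.log_pos (by linarith [Real.exp_pos t])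

theorem lt_softplus (t : ℝ) : t < softplus t := by
  rw [softplus, Real.lt_log_iff_exp_lt (by positivity)]
  exact lt_one_add _

theorem hasDerivAt_softplus (t : ℝ) : HasDerivAt softplus (Real.sigmoid t) t := by
  convert! ((Real.hasDerivAt_exp t).const_add 1).log (by positivity) using 1
  rw [Real.sigmoid_def, Real.exp_neg]
  field_simp
  ring

theorem softplus_injective : Function.Injective softplus :=
  (strictMono_of_hasDerivAt_pos hasDerivAt_softplus fun t => Real.sigmoid_pos t).injective

theorem range_softplus : Set.range softplus = Set.Ioi 0 := by
  refine (Set.range_subset_iff.2 softplus_pos).antisymm fun x (hx : 0 < x) => ?_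
  have : 0 < Real.exp x - 1 := sub_pos.2 (Real.one_lt_exp_iff.2 hx)
  exact ⟨Real.log (Real.exp x - 1), by simp [softplus, Real.exp_log this]⟩

theorem gReal_pos (α c t : ℝ) : 0 < gReal α c t :=
  mul_pos (Real.sigmoid_pos t) (Real.exp_pos _)

theorem abs_sigmoid_smul_eq_gReal (α c : ℝ) :
    (fun t => |Real.sigmoid t| • Real.exp (-c * softplus t ^ (1 / α))) = gReal α c := by
  ext t
  rw [abs_of_pos (Real.sigmoid_pos t), smul_eq_mul, gReal]

section

variable {α c : ℝ}

theorem integrable_gReal (hα : 0 < α) (hc : 0 < c) : Integrable (gReal α c) := by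
  have hexp_int : IntegrableOn (fun x => Real.exp (-c * x ^ (1 / α))) (softplus '' Set.univ) := by
    rw [Set.image_univ, range_softplus]
    simpa using integrableOn_rpow_mul_exp_neg_mul_rpow (s := 0) (by norm_num)
      (one_div_pos.2 hα) hc
  rw [integrableOn_image_iff_integrableOn_abs_deriv_smul MeasurableSet.univ
    (fun t _ => (hasDerivAt_softplus t).hasDerivWithinAt) softplus_injective.injOn,
    integrableOn_univ] at hexp_int
  rwa [← abs_sigmoid_smul_eq_gReal]

theorem integral_gReal (hα : 0 < α) (hc : 0 < c) :
    ∫ t, gReal α c t = c ^ (-α) * Real.Gamma (α + 1) := by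
  have hsubst := integral_image_eq_integral_abs_deriv_smul MeasurableSet.univ
    (fun t _ => (hasDerivAt_softplus t).hasDerivWithinAt) softplus_injective.injOn
    (fun x => Real.exp (-c * x ^ (1 / α)))
  rw [Set.image_univ, range_softplus, setIntegral_univ, abs_sigmoid_smul_eq_gReal,
    integral_exp_neg_mul_rpow (one_div_pos.2 hα) hc, one_div_one_div] at hsubst
  rw [← hsubst, show -1 / (1 / α) = -α by field_simp]

theorem sigmoid_le_exp (t : ℝ) : Real.sigmoid t ≤ Real.exp t := by
  rw [Real.sigmoid_def, ← inv_inv (Real.exp t), ← Real.exp_neg]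
  exact inv_anti₀ (Real.exp_pos _) (lt_one_add _).le

theorem gReal_le_exp (hc : 0 ≤ c) (t : ℝ) : gReal α c t ≤ Real.exp t := by
  have hexp : Real.exp (-c * softplus t ^ (1 / α)) ≤ 1 := by
    rw [Real.exp_le_one_iff, neg_mul, neg_nonpos]
    exact mul_nonneg hc (Real.rpow_nonneg (softplus_pos t).le _)
  exact (mul_le_of_le_one_right (Real.sigmoid_pos t).le hexp).trans (sigmoid_le_exp t)

theorem gReal_le_exp_neg (hα : 0 < α) (hc : 0 ≤ c) {t : ℝ} (ht : 0 ≤ t) :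
    gReal α c t ≤ Real.exp (-c * t ^ (1 / α)) := by
  refine (mul_le_of_le_one_left (Real.exp_nonneg _) (Real.sigmoid_le_one t)).trans
    (Real.exp_le_exp.2 ?_)
  rw [neg_mul, neg_mul, neg_le_neg_iff]
  have := (lt_softplus t).le
  gcongr

theorem gReal_isBigO_atBot (hc : 0 ≤ c) (b : ℝ) : gReal α c =O[atBot] fun t => |t| ^ b := by
  have hexp : (fun t : ℝ => Real.exp (-1 * -t)) =O[atBot] fun t => (-t) ^ b :=
    ((isLittleO_exp_neg_mul_rpow_atTop one_pos b).comp_tendsto tendsto_neg_atBot_atTop).isBigO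
  refine (IsBigO.of_norm_le fun t => ?_).trans (hexp.congr' .rfl ?_)
  · rw [Real.norm_of_nonneg (gReal_pos _ _ _).le]
    simpa using gReal_le_exp hc t
  · filter_upwards [eventually_le_atBot 0] with t ht
    rw [abs_of_nonpos ht]

theorem gReal_isBigO_atTop (hα : 0 < α) (hc : 0 < c) (b : ℝ) :
    gReal α c =O[atTop] fun t => |t| ^ b := by
  have hexp : (fun t : ℝ => Real.exp (-c * t ^ (1 / α))) =O[atTop]
      fun t => (t ^ (1 / α)) ^ (α * b) :=
    ((isLittleO_exp_neg_mul_rpow_atTop hc (α * b)).comp_tendsto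
      (tendsto_rpow_atTop (one_div_pos.2 hα))).isBigO
  refine (IsBigO.of_norm_eventuallyLE ?_).trans (hexp.congr' .rfl ?_)
  · filter_upwards [eventually_ge_atTop 0] with t ht
    rw [Real.norm_of_nonneg (gReal_pos _ _ _).le]
    exact gReal_le_exp_neg hα hc.le ht
  · filter_upwards [eventually_ge_atTop 0] with t ht
    rw [abs_of_nonneg ht, ← Real.rpow_mul ht]
    field_simp

theorem gReal_isBigO (hα : 0 < α) (hc : 0 < c) (b : ℝ) :
    gReal α c =O[cocompact ℝ] fun t => |t| ^ b := by
  rw [cocompact_eq_atBot_atTop, isBigO_sup]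
  exact ⟨gReal_isBigO_atBot hc.le b, gReal_isBigO_atTop hα hc b⟩

end

theorem cos_mul_le_norm_one_add_exp {z : ℂ} (hz : 0 ≤ Real.cos z.im) :
    Real.cos z.im * (1 + Real.exp z.re) ≤ ‖1 + exp z‖ := by
  have normSq_eq : normSq (1 + exp z) =
      1 + 2 * (Real.exp z.re * Real.cos z.im) + Real.exp z.re ^ 2 := by
    simp only [normSq_apply, add_re, one_re, exp_re, add_im, one_im, exp_im, zero_add]
    linear_combination Real.exp z.re ^ 2 * Real.sin_sq_add_cos_sq z.im
  rw [norm_def, normSq_eq]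
  refine Real.le_sqrt_of_sq_le ?_
  have hcos_sq : Real.cos z.im ^ 2 ≤ 1 := Real.cos_sq_le_one _
  have hmid : 0 ≤ Real.exp z.re * (Real.cos z.im * (1 - Real.cos z.im)) :=
    mul_nonneg (Real.exp_nonneg _) (mul_nonneg hz (sub_nonneg.2 (Real.cos_le_one _)))
  nlinarith [sq_nonneg (Real.exp z.re)]

theorem re_one_add_exp_pos {z : ℂ} (hz : 0 ≤ Real.cos z.im) : 0 < (1 + exp z).re := by
  rw [add_re, one_re, exp_re]
  positivity

theorem cos_mul_softplus_le_re_log {z : ℂ} (hz : 0 ≤ Real.cos z.im) :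
    Real.cos z.im * softplus z.re ≤ (log (1 + exp z)).re := by
  have bernoulli : (1 + Real.exp z.re) ^ Real.cos z.im ≤ 1 + Real.cos z.im * Real.exp z.re :=
    rpow_one_add_le_one_add_mul_self (neg_one_lt_zero.trans (Real.exp_pos _)).le hz
      (Real.cos_le_one _)
  have re_le : 1 + Real.cos z.im * Real.exp z.re ≤ ‖1 + exp z‖ := by
    refine (le_of_eq ?_).trans (re_le_norm _)
    rw [add_re, one_re, exp_re, mul_comm]
  rw [log_re, softplus, ← Real.log_rpow (by positivity)]
  exact Real.log_le_log (by positivity) (bernoulli.trans re_le)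

theorem hasDerivAt_conj_mul_log_one_add_mul {u : ℂ} {s : ℝ} (hs : 1 + s * u ∈ slitPlane) :
    HasDerivAt (fun s : ℝ => conj u * log (1 + s * u)) (normSq u * (1 + s * u)⁻¹) s := by
  have hline : HasDerivAt (fun s : ℝ => 1 + (s : ℂ) * u) u s := by
    simpa using ((hasDerivAt_id s).ofReal_comp.mul_const u).const_add (1 : ℂ)
  convert! (hline.clog_real hs).const_mul (conj u) using 1
  rw [normSq_eq_conj_mul_self, mul_assoc, div_eq_mul_inv]

/- Along the ray `s ↦ s u` the derivative `|u|² / (1 + s u)` of `conj u * log (1 + s u)` has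
nonpositive imaginary part. -/
theorem im_conj_mul_log_one_add_nonpos {u : ℂ} (hre : 0 ≤ u.re) (him : 0 ≤ u.im) :
    (conj u * log (1 + u)).im ≤ 0 := by
  have hslit (s : ℝ) (hs : 0 ≤ s) : 1 + s * u ∈ slitPlane := by
    refine Or.inl ?_
    simp only [add_re, one_re, re_ofReal_mul]
    positivity
  have hderiv (s : ℝ) (hs : 0 ≤ s) :
      HasDerivAt (fun s : ℝ => (conj u * log (1 + s * u)).im)
        ((normSq u * (1 + s * u)⁻¹ : ℂ).im) s :=
    imCLM.hasFDerivAt.comp_hasDerivAt s (hasDerivAt_conj_mul_log_one_add_mul (hslit s hs))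
  have hanti : AntitoneOn (fun s : ℝ => (conj u * log (1 + s * u)).im) (Set.Ici 0) := by
    refine antitoneOn_of_hasDerivWithinAt_nonpos (convex_Ici 0)
      (fun s hs => (hderiv s hs).continuousAt.continuousWithinAt)
      (fun s hs => (hderiv s (interior_subset hs)).hasDerivWithinAt) fun s hs => ?_
    have hs : 0 ≤ s := interior_subset (s := Set.Ici (0 : ℝ)) hs
    rw [im_ofReal_mul, inv_im, add_im, one_im, zero_add, im_ofReal_mul]
    exact mul_nonpos_of_nonneg_of_nonpos (normSq_nonneg _)
      (div_nonpos_of_nonpos_of_nonneg (neg_nonpos.2 (mul_nonneg hs him)) (normSq_nonneg _))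
  simpa using hanti Set.self_mem_Ici (zero_le_one' ℝ) zero_le_one

theorem arg_le_arg_of_im_conj_mul_nonpos {u v : ℂ} (hu : u ≠ 0) (hv : v ≠ 0) (hu_im : 0 ≤ u.im)
    (hv_arg : arg v < Real.pi) (h : (conj u * v).im ≤ 0) : arg v ≤ arg u := by
  by_contra! hlt
  have hsin : 0 < Real.sin (arg v - arg u) :=
    Real.sin_pos_of_pos_of_lt_pi (sub_pos.2 hlt) (by linarith [arg_nonneg_iff.2 hu_im])
  have im_eq : (conj u * v).im = ‖u‖ * ‖v‖ * Real.sin (arg v - arg u) := by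
    rw [mul_im, conj_re, conj_im, Real.sin_sub, ← norm_mul_cos_arg u, ← norm_mul_sin_arg u,
      ← norm_mul_cos_arg v, ← norm_mul_sin_arg v]
    ring_nf
  have : 0 < (conj u * v).im := by
    rw [im_eq]
    positivity
  exact this.not_ge h

theorem re_log_one_add_pos {u : ℂ} (hu : 0 < u.re) : 0 < (log (1 + u)).re := by
  rw [log_re]
  refine Real.log_pos (lt_of_lt_of_le ?_ (re_le_norm _))
  simpa using hu

theorem abs_arg_log_one_add_le_of_im_nonneg {u : ℂ} (hre : 0 < u.re) (him : 0 ≤ u.im) :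
    |arg (log (1 + u))| ≤ |arg u| := by
  have hlog_re := re_log_one_add_pos hre
  have hlog_im : 0 ≤ (log (1 + u)).im := by
    rw [log_im, arg_nonneg_iff]
    simpa using him
  have hlog_arg : |arg (log (1 + u))| < Real.pi / 2 := abs_arg_lt_pi_div_two_iff.2 (.inl hlog_re)
  rw [abs_of_nonneg (arg_nonneg_iff.2 hlog_im), abs_of_nonneg (arg_nonneg_iff.2 him)]
  exact arg_le_arg_of_im_conj_mul_nonpos (fun h => by simp [h] at hre)
    (fun h => by simp [h] at hlog_re) him
    ((le_abs_self _).trans_lt (hlog_arg.trans (half_lt_self Real.pi_pos)))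
    (im_conj_mul_log_one_add_nonpos hre.le him)

theorem arg_ne_pi_of_re_pos {z : ℂ} (hz : 0 < z.re) : arg z ≠ Real.pi := fun h =>
  hz.not_gt (arg_eq_pi_iff.1 h).1

theorem abs_arg_log_one_add_le {u : ℂ} (hu : 0 < u.re) : |arg (log (1 + u))| ≤ |arg u| := by
  obtain him | him := le_total 0 u.im
  · exact abs_arg_log_one_add_le_of_im_nonneg hu him
  · have hre : 0 < (1 + u).re := by
      rw [add_re, one_re]
      positivity
    have hconj := abs_arg_log_one_add_le_of_im_nonneg (u := conj u) (by simpa using hu)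
      (by simpa using him)
    rwa [← map_one conj, ← map_add, log_conj _ (arg_ne_pi_of_re_pos hre), arg_conj, arg_conj,
      if_neg (arg_ne_pi_of_re_pos (re_log_one_add_pos hu)), if_neg (arg_ne_pi_of_re_pos hu),
      abs_neg, abs_neg] at hconj

theorem abs_arg_log_one_add_exp_le {z : ℂ} (hz : |z.im| < Real.pi / 2) :
    |arg (log (1 + exp z))| ≤ |z.im| := by
  obtain ⟨hz_gt, hz_lt⟩ := abs_lt.1 hz
  have arg_exp : arg (exp z) = z.im := by
    rw [← log_im, log_exp (by linarith [Real.pi_pos]) (by linarith [Real.pi_pos])]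
  have hcos : 0 < Real.cos z.im := Real.cos_pos_of_mem_Ioo ⟨hz_gt, hz_lt⟩
  have hre : 0 < (exp z).re := by
    rw [exp_re]
    positivity
  simpa only [arg_exp] using abs_arg_log_one_add_le hre

theorem cos_pos_of_abs_le {d y : ℝ} (hd : d < Real.pi / 2) (hy : |y| ≤ d) : 0 < Real.cos y :=
  Real.cos_pos_of_mem_Ioo (abs_lt.1 (hy.trans_lt hd))

theorem cos_le_cos_of_abs_le {x y : ℝ} (hy : y ≤ Real.pi) (hx : |x| ≤ y) :
    Real.cos y ≤ Real.cos x := by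
  rw [← Real.cos_abs x]
  exact Real.cos_le_cos_of_nonneg_of_le_pi (abs_nonneg x) hy hx

/-- The exponential rate of the function dominating `g` on the strip of half width `d`:
`‖g α ξ z‖` is at most a constant times `gReal α (ξ * rate α d) z.re`. -/
noncomputable def rate (α d : ℝ) : ℝ := Real.cos d ^ (1 / α) * Real.cos (d / α)

section Strip

variable {α d ξ : ℝ}

theorem rate_pos (hα : 0 < α) (hd0 : 0 ≤ d) (hd : d < Real.pi / 2) (hdα : d / α < Real.pi / 2) :
    0 < rate α d := by
  have hcos := cos_pos_of_abs_le hd (abs_of_nonneg hd0).le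
  have hcosα := cos_pos_of_abs_le hdα (abs_of_nonneg (by positivity)).le
  exact mul_pos (Real.rpow_pos_of_pos hcos _) hcosα

theorem g_ofReal (α ξ t : ℝ) : g α ξ t = (gReal α ξ t : ℂ) := by
  have log_eq : log (1 + exp t) = (softplus t : ℂ) := by
    rw [softplus, ofReal_log (by positivity)]
    push_cast
    rfl
  rw [g, log_eq, ← ofReal_cpow (softplus_pos t).le, gReal, Real.sigmoid_def]
  push_cast
  rw [div_eq_mul_inv, mul_comm]
  congr 2
  ring

theorem one_add_exp_neg_ne_zero {z : ℂ} (hz : 0 ≤ Real.cos z.im) : 1 + exp (-z) ≠ 0 := fun h => by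
  simpa [h] using re_one_add_exp_pos (z := -z) (by simpa using hz)

theorem differentiableAt_g (α ξ : ℝ) {z : ℂ} (hz : |z.im| < Real.pi / 2) :
    DifferentiableAt ℂ (g α ξ) z := by
  have hcos := Real.cos_pos_of_mem_Ioo (abs_lt.1 hz)
  have hslit : 1 + exp z ∈ slitPlane := .inl (re_one_add_exp_pos hcos.le)
  have hslit_log : log (1 + exp z) ∈ slitPlane :=
    .inl ((mul_pos hcos (softplus_pos z.re)).trans_le (cos_mul_softplus_le_re_log hcos.le))
  have hpow : DifferentiableAt ℂ (fun z => log (1 + exp z) ^ ((1 / α : ℝ) : ℂ)) z :=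
    (DifferentiableAt.clog (f := fun z => 1 + exp z) (by fun_prop) hslit).cpow
      (by fun_prop) hslit_log
  exact (hpow.neg.mul_const _).cexp.div (by fun_prop) (one_add_exp_neg_ne_zero hcos.le)

theorem cos_mul_inv_sigmoid_le_norm (hd : d < Real.pi / 2) {z : ℂ} (hz : |z.im| ≤ d) :
    Real.cos d * (Real.sigmoid z.re)⁻¹ ≤ ‖1 + exp (-z)‖ := by
  have hcos := cos_pos_of_abs_le hd hz
  have hcosd : Real.cos d ≤ Real.cos z.im := cos_le_cos_of_abs_le (by linarith [Real.pi_pos]) hz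
  have hnorm := cos_mul_le_norm_one_add_exp (z := -z) (by simpa using hcos.le)
  rw [neg_im, neg_re, Real.cos_neg] at hnorm
  rw [Real.sigmoid_def, inv_inv]
  exact (mul_le_mul_of_nonneg_right hcosd (by positivity)).trans hnorm

theorem rate_mul_le_re_log_cpow (hα : 0 < α) (hd : d < Real.pi / 2) (hdα : d / α ≤ Real.pi / 2)
    {z : ℂ} (hz : |z.im| ≤ d) :
    rate α d * softplus z.re ^ (1 / α) ≤ (log (1 + exp z) ^ ((1 / α : ℝ) : ℂ)).re := by
  set L := log (1 + exp z)
  have hd0 : 0 ≤ d := (abs_nonneg _).trans hz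
  have hcosd : 0 < Real.cos d := cos_pos_of_abs_le hd (abs_of_nonneg hd0).le
  have hcos_le : Real.cos d ≤ Real.cos z.im := cos_le_cos_of_abs_le (by linarith [Real.pi_pos]) hz
  have hsoftplus := softplus_pos z.re
  have norm_ge : Real.cos d * softplus z.re ≤ ‖L‖ :=
    (mul_le_mul_of_nonneg_right hcos_le hsoftplus.le).trans
      ((cos_mul_softplus_le_re_log (cos_pos_of_abs_le hd hz).le).trans (re_le_norm _))
  have arg_le : |arg L * (1 / α)| ≤ d / α := by
    rw [abs_mul, abs_of_pos (one_div_pos.2 hα), mul_one_div]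
    exact div_le_div_of_nonneg_right ((abs_arg_log_one_add_exp_le (hz.trans_lt hd)).trans hz) hα.le
  have cos_ge : Real.cos (d / α) ≤ Real.cos (arg L * (1 / α)) :=
    cos_le_cos_of_abs_le (by linarith [Real.pi_pos]) arg_le
  have hcosα : 0 ≤ Real.cos (d / α) :=
    Real.cos_nonneg_of_mem_Icc ⟨by linarith [Real.pi_pos, show 0 ≤ d / α by positivity], hdα⟩
  rw [cpow_ofReal_re, rate]
  calc Real.cos d ^ (1 / α) * Real.cos (d / α) * softplus z.re ^ (1 / α)
      = (Real.cos d * softplus z.re) ^ (1 / α) * Real.cos (d / α) := by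
        rw [Real.mul_rpow hcosd.le hsoftplus.le]
        ring
    _ ≤ ‖L‖ ^ (1 / α) * Real.cos (arg L * (1 / α)) := by gcongr

theorem norm_g_le (hα : 0 < α) (hξ : 0 ≤ ξ) (hd : d < Real.pi / 2) (hdα : d / α ≤ Real.pi / 2)
    {z : ℂ} (hz : |z.im| ≤ d) :
    ‖g α ξ z‖ ≤ (Real.cos d)⁻¹ * gReal α (ξ * rate α d) z.re := by
  have hcosd : 0 < Real.cos d :=
    cos_pos_of_abs_le hd (abs_of_nonneg ((abs_nonneg _).trans hz)).le
  have hsigmoid := Real.sigmoid_pos z.re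
  have hre := mul_le_mul_of_nonneg_left (rate_mul_le_re_log_cpow hα hd hdα hz) hξ
  rw [g, norm_div, norm_exp]
  calc _ ≤ Real.exp (-(ξ * rate α d) * softplus z.re ^ (1 / α)) /
        (Real.cos d * (Real.sigmoid z.re)⁻¹) := by
        gcongr
        · rw [re_mul_ofReal, neg_re]
          linarith
        · exact cos_mul_inv_sigmoid_le_norm hd hz
    _ = (Real.cos d)⁻¹ * gReal α (ξ * rate α d) z.re := by
        rw [gReal, div_eq_mul_inv, mul_inv, inv_inv]
        ring

theorem stripDominated_g (hα : 0 < α) (hξ : 0 < ξ) (hd0 : 0 ≤ d) (hd : d < Real.pi / 2)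
    (hdα : d / α < Real.pi / 2) :
    StripDominated d (g α ξ) fun t => (Real.cos d)⁻¹ * gReal α (ξ * rate α d) t where
  differentiableAt _ hz := differentiableAt_g α ξ (hz.trans_lt hd)
  norm_le _ hz := norm_g_le hα hξ.le hd hdα.le hz
  integrable := (integrable_gReal hα (mul_pos hξ (rate_pos hα hd0 hd hdα))).const_mul _

theorem stripNorm_g_le_Gamma_div (hα : 0 < α) (hξ : 0 < ξ) (hd0 : 0 ≤ d) (hd : d < Real.pi / 2)
    (hdα : d / α < Real.pi / 2) :
    stripNorm d (g α ξ) ≤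
      2 * (Real.Gamma (α + 1) / (ξ ^ α * Real.cos d ^ 2 * Real.cos (d / α) ^ α)) := by
  have hrate := rate_pos hα hd0 hd hdα
  have hcos := cos_pos_of_abs_le hd (abs_of_nonneg hd0).le
  have hcosα := cos_pos_of_abs_le hdα (abs_of_nonneg (by positivity)).le
  have rate_rpow : rate α d ^ α = Real.cos d * Real.cos (d / α) ^ α := by
    rw [rate, Real.mul_rpow (by positivity) hcosα.le, ← Real.rpow_mul hcos.le,
      one_div_mul_cancel hα.ne', Real.rpow_one]
  refine ((stripDominated_g hα hξ hd0 hd hdα).stripNorm_le hd0).trans_eq ?_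
  rw [integral_const_mul, integral_gReal hα (by positivity), Real.rpow_neg (by positivity),
    Real.mul_rpow hξ.le hrate.le, rate_rpow]
  field_simp

theorem inv_le_cos_pi_div_eight_pow_three : (1.27 : ℝ)⁻¹ ≤ Real.cos (Real.pi / 8) ^ 3 := by
  have sqrt_two_ge : (1.4142 : ℝ) ≤ √2 := Real.le_sqrt_of_sq_le (by norm_num)
  have hcos : (0.9238 : ℝ) ≤ Real.cos (Real.pi / 8) := by
    rw [Real.cos_pi_div_eight, le_div_iff₀ two_pos]
    exact Real.le_sqrt_of_sq_le (by norm_num; linarith)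
  calc (1.27 : ℝ)⁻¹ ≤ 0.9238 ^ 3 := by norm_num
    _ ≤ Real.cos (Real.pi / 8) ^ 3 := by gcongr

theorem stripNorm_g_le (hα0 : 0 < α) (hα1 : α ≤ 1) (hd0 : 0 ≤ d) (hd : d ≤ Real.pi * α / 8)
    (hξ : 1 ≤ ξ) : stripNorm d (g α ξ) ≤ 2.54 * Real.Gamma (α + 1) := by
  have hpi := Real.pi_pos
  have hd_le : d ≤ Real.pi / 8 := hd.trans (by gcongr; exact mul_le_of_le_one_right hpi.le hα1)
  have hdα_le : d / α ≤ Real.pi / 8 := by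
    rw [div_le_iff₀ hα0]
    linarith
  have := Real.Gamma_pos_of_pos (add_pos hα0 one_pos)
  set k := Real.cos (Real.pi / 8)
  have hk : 0 < k := Real.cos_pos_of_mem_Ioo ⟨by linarith, by linarith⟩
  have hk_le : k ≤ Real.cos d := Real.cos_le_cos_of_nonneg_of_le_pi hd0 (by linarith) hd_le
  have hk_leα : k ≤ Real.cos (d / α) ^ α := by
    have hcos : k ≤ Real.cos (d / α) :=
      Real.cos_le_cos_of_nonneg_of_le_pi (by positivity) (by linarith) hdα_le
    exact hcos.trans
      (Real.self_le_rpow_of_le_one (hk.le.trans hcos) (Real.cos_le_one _) hα1)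
  have denom_ge : (1.27 : ℝ)⁻¹ ≤ ξ ^ α * Real.cos d ^ 2 * Real.cos (d / α) ^ α :=
    calc (1.27 : ℝ)⁻¹ ≤ k ^ 3 := inv_le_cos_pi_div_eight_pow_three
      _ = 1 * k ^ 2 * k := by ring
      _ ≤ ξ ^ α * Real.cos d ^ 2 * Real.cos (d / α) ^ α := by
        have := Real.one_le_rpow hξ hα0.le
        gcongr
  calc stripNorm d (g α ξ)
      ≤ 2 * (Real.Gamma (α + 1) / (ξ ^ α * Real.cos d ^ 2 * Real.cos (d / α) ^ α)) :=
        stripNorm_g_le_Gamma_div hα0 (by linarith) hd0 (by linarith) (by linarith)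
    _ ≤ 2 * (Real.Gamma (α + 1) / (1.27 : ℝ)⁻¹) := by gcongr
    _ = 2.54 * Real.Gamma (α + 1) := by ring

theorem abs_sub_trapezoidal_gReal_le {h : ℝ} (hα : 0 < α) (hξ : 0 < ξ) (hd0 : 0 < d)
    (hd : d < Real.pi / 2) (hdα : d / α < Real.pi / 2) (hh : 0 < h) :
    |ξ ^ (-α) * Real.Gamma (α + 1) - h * ∑' j : ℤ, gReal α ξ (j * h)| ≤
      stripNorm d (g α ξ) / (Real.exp (2 * Real.pi * d / h) - 1) := by
  have hrate := rate_pos hα hd0.le hd hdα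
  have trapezoidal := (stripDominated_g hα hξ hd0.le hd hdα).norm_integral_sub_trapezoidal_le
    hd0 hh one_lt_two ((gReal_isBigO hα (mul_pos hξ hrate) _).const_mul_left _)
  have integral_eq : ∫ t : ℝ, g α ξ t = ((ξ ^ (-α) * Real.Gamma (α + 1) : ℝ) : ℂ) := by
    simp_rw [g_ofReal]
    rw [integral_complex_ofReal, integral_gReal hα hξ]
  have tsum_eq : ∑' j : ℤ, g α ξ (j * h) = ((∑' j : ℤ, gReal α ξ (j * h) : ℝ) : ℂ) := by
    rw [ofReal_tsum]
    congr 1 with j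
    rw [← g_ofReal, ofReal_mul, ofReal_intCast]
  rwa [integral_eq, tsum_eq, ← ofReal_mul, ← ofReal_sub, norm_real, Real.norm_eq_abs]
    at trapezoidal

end Strip

section Truncation

theorem tangent_le_rpow {p x y : ℝ} (hp : 1 ≤ p) (hx : 0 < x) (hy : 0 ≤ y) :
    x ^ p + (y - x) * (p * x ^ p / x) ≤ y ^ p := by
  have hyx : 0 ≤ y / x := by positivity
  have bernoulli := one_add_mul_self_le_rpow_one_add (s := y / x - 1) (by linarith) hp
  rw [add_sub_cancel, Real.div_rpow hy hx.le, le_div_iff₀ (Real.rpow_pos_of_pos hx p)] at bernoulli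
  refine (le_of_eq ?_).trans bernoulli
  field_simp

/-- `h` times the slope at `n * h` of `x ^ (1 / α)`: by convexity, the terms of the right tail
beyond the cut-off `n` decay geometrically with ratio `exp (-tailRate α h n)`. -/
noncomputable def tailRate (α h : ℝ) (n : ℕ) : ℝ := (n * h) ^ (1 / α) / (α * n)

variable {α h ξ : ℝ} {n : ℕ}

theorem tailRate_pos (hα : 0 < α) (hh : 0 < h) (hn : 0 < n) : 0 < tailRate α h n := by
  unfold tailRate
  positivity

theorem rpow_le_tailRate (hα0 : 0 < α) (hα1 : α ≤ 1) (hh : 0 ≤ h) (hn : 0 < n) :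
    h ^ (1 / α) ≤ tailRate α h n := by
  have hn1 : (1 : ℝ) ≤ n := Nat.one_le_cast.2 hn
  have n_le : (n : ℝ) ≤ n ^ (1 / α) := Real.self_le_rpow_of_one_le hn1 (one_le_one_div hα0 hα1)
  have αn_le : α * n ≤ n ^ (1 / α) := (mul_le_of_le_one_left n.cast_nonneg hα1).trans n_le
  rw [tailRate, Real.mul_rpow n.cast_nonneg hh, le_div_iff₀ (by positivity), mul_comm]
  gcongr

theorem step_le_mul_tailRate (hα0 : 0 < α) (hα1 : α ≤ 1) (hn : 0 < n) (hnh : 1 ≤ n * h) :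
    h ≤ α * tailRate α h n := by
  have : (0 : ℝ) < n := Nat.cast_pos.2 hn
  have nh_le : n * h ≤ (n * h) ^ (1 / α) :=
    Real.self_le_rpow_of_one_le hnh (one_le_one_div hα0 hα1)
  calc h = n * h / n := by field_simp
    _ ≤ (n * h) ^ (1 / α) / n := by gcongr
    _ = α * tailRate α h n := by
      rw [tailRate]
      field_simp

theorem gReal_le_exp_neg_tangent (hα0 : 0 < α) (hα1 : α ≤ 1) (hξ : 1 ≤ ξ) (hh : 0 < h)
    (hn : 0 < n) (k : ℕ) :
    gReal α ξ ((k + (n + 1)) * h) ≤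
      Real.exp (-((n * h) ^ (1 / α) + (k + 1) * tailRate α h n)) := by
  have : (0 : ℝ) < n := Nat.cast_pos.2 hn
  set x := ((k : ℝ) + (n + 1)) * h
  have hx : 0 ≤ x := by positivity
  refine (gReal_le_exp_neg hα0 (zero_le_one.trans hξ) hx).trans (Real.exp_le_exp.2 ?_)
  rw [neg_mul, neg_le_neg_iff]
  calc (n * h) ^ (1 / α) + (k + 1) * tailRate α h n
      = (n * h) ^ (1 / α) + (x - n * h) * (1 / α * (n * h) ^ (1 / α) / (n * h)) := by
        rw [tailRate]
        field_simp
        ring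
    _ ≤ x ^ (1 / α) := tangent_le_rpow (one_le_one_div hα0 hα1) (by positivity) hx
    _ ≤ ξ * x ^ (1 / α) := le_mul_of_one_le_left (Real.rpow_nonneg hx _) hξ

theorem abs_tsum_gReal_sub_sum_le (hα0 : 0 < α) (hα1 : α ≤ 1) (hξ : 1 ≤ ξ) (hh : 0 < h)
    (hn : 0 < n) (m : ℕ) :
    |∑' j : ℤ, gReal α ξ (j * h) - ∑ j ∈ Finset.Icc (-(m : ℤ)) n, gReal α ξ (j * h)| ≤
      Real.exp (-((n * h) ^ (1 / α))) / (Real.exp (tailRate α h n) - 1) +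
        Real.exp (-(m * h)) / (Real.exp h - 1) := by
  refine norm_tsum_int_sub_sum_Icc_le (f := fun j : ℤ => gReal α ξ (j * h))
    (hasSum_exp_neg_arith (tailRate_pos hα0 hh hn) _) (hasSum_exp_neg_arith hh _)
    (fun k => ?_) fun k => ?_ <;>
  rw [Real.norm_of_nonneg (gReal_pos _ _ _).le]
  · simpa using gReal_le_exp_neg_tangent hα0 hα1 hξ hh hn k
  · refine (gReal_le_exp (zero_le_one.trans hξ) _).trans_eq ?_
    push_cast
    ring_nf

end Truncation

section Parameters

variable {α d ε ξ : ℝ}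

theorem log_inv_pos (hε0 : 0 < ε) (hε1 : ε < 1) : 0 < Real.log ε⁻¹ :=
  Real.log_pos ((one_lt_inv₀ hε0).2 hε1)

theorem step_pos (hd : 0 < d) (hε0 : 0 < ε) (hε1 : ε < 1) : 0 < step d ε :=
  div_pos (by positivity) (log_inv_pos hε0 hε1)

theorem two_pi_mul_div_step (hd : 0 < d) (ε : ℝ) :
    2 * Real.pi * d / step d ε = Real.log ε⁻¹ := by
  rw [step, div_div_cancel₀ (by positivity)]

theorem exp_neg_le_of_log_inv_le (hε : 0 < ε) {x : ℝ} (hx : Real.log ε⁻¹ ≤ x) :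
    Real.exp (-x) ≤ ε := by
  rwa [← Real.le_log_iff_exp_le hε, neg_le, ← Real.log_inv]

theorem cos_pi_div_four_le_beta (hα : 0 < α) (hd0 : 0 ≤ d) (hd : d ≤ Real.pi * α / 8) :
    Real.cos (Real.pi / 4) ≤ beta α d := by
  refine Real.cos_le_cos_of_nonneg_of_le_pi (by positivity) (by linarith [Real.pi_pos]) ?_
  rw [div_le_iff₀ hα]
  linarith

theorem div_lt_pi_div_four (hα : 0 < α) (hd : d ≤ Real.pi * α / 8) : d / α < Real.pi / 4 := by
  rw [div_lt_iff₀ hα]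
  linarith [mul_pos Real.pi_pos hα]

theorem beta_pos (hα : 0 < α) (hd0 : 0 ≤ d) (hdα : d / α < Real.pi / 4) : 0 < beta α d := by
  refine cos_pos_of_abs_le (d := 2 * d / α) ?_ (abs_of_nonneg (by positivity)).le
  rw [mul_div_assoc]
  linarith

theorem beta_le_one (α d : ℝ) : beta α d ≤ 1 := Real.cos_le_one _

theorem log_inv_le_Nminus_mul_step (hd : 0 < d) (hε0 : 0 < ε) (hε1 : ε < 1) :
    Real.log ε⁻¹ ≤ Nminus d ε * step d ε := by
  have hh := step_pos hd hε0 hε1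
  calc Real.log ε⁻¹ = 2 * Real.pi * d / step d ε ^ 2 * step d ε := by
        rw [← two_pi_mul_div_step hd]
        field_simp
    _ ≤ Nminus d ε * step d ε := by
        gcongr
        exact Nat.le_ceil _

theorem Nplus_pos (hd : 0 < d) (hβ : 0 < beta α d) (hε0 : 0 < ε) (hε1 : ε < 1) :
    0 < Nplus α d ε := by
  have := step_pos hd hε0 hε1
  exact Nat.ceil_pos.2 (by positivity)

theorem log_inv_le_Nplus_mul_step_rpow (hα : 0 < α) (hd : 0 < d) (hβ : 0 < beta α d)
    (hε0 : 0 < ε) (hε1 : ε < 1) : Real.log ε⁻¹ ≤ (Nplus α d ε * step d ε) ^ (1 / α) := by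
  have hh := step_pos hd hε0 hε1
  have hL := log_inv_pos hε0 hε1
  set x := 2 * Real.pi * d * step d ε ^ (-((α + 1) / α)) / beta α d
  have hx : 0 ≤ x := by positivity
  have x_le : x ≤ Nplus α d ε ^ (1 / α) := by
    rw [one_div, Real.le_rpow_inv_iff_of_pos hx (Nat.cast_nonneg _) hα]
    exact Nat.le_ceil _
  have step_rpow : step d ε ^ (-((α + 1) / α)) * step d ε ^ (1 / α) = (step d ε)⁻¹ := by
    rw [← Real.rpow_add hh, ← Real.rpow_neg_one]
    congr 1
    field_simp
    ring
  calc Real.log ε⁻¹ ≤ Real.log ε⁻¹ / beta α d := le_div_self hL.le hβ (beta_le_one α d)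
    _ = x * step d ε ^ (1 / α) := by
        rw [← two_pi_mul_div_step hd, div_eq_mul_inv (2 * Real.pi * d) (step d ε), ← step_rpow]
        ring
    _ ≤ Nplus α d ε ^ (1 / α) * step d ε ^ (1 / α) := by gcongr
    _ = (Nplus α d ε * step d ε) ^ (1 / α) := (Real.mul_rpow (Nat.cast_nonneg _) hh.le).symm

theorem approx_eq (α d ε ξ : ℝ) :
    approx α d ε ξ = (((Real.Gamma (α + 1))⁻¹ * (step d ε *
      ∑ j ∈ Finset.Icc (-(Nminus d ε : ℤ)) (Nplus α d ε), gReal α ξ (j * step d ε)) : ℝ) : ℂ) := by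
  rw [approx, truncSinc, ← Finset.sum_div]
  push_cast
  simp_rw [← g_ofReal]
  push_cast
  ring

theorem err_eq (hα : 0 < α) (d ε ξ : ℝ) :
    err α d ε ξ = (Real.Gamma (α + 1))⁻¹ * |ξ ^ (-α) * Real.Gamma (α + 1) - step d ε *
      ∑ j ∈ Finset.Icc (-(Nminus d ε : ℤ)) (Nplus α d ε), gReal α ξ (j * step d ε)| := by
  have hΓ := Real.Gamma_pos_of_pos (add_pos hα one_pos)
  rw [err, approx_eq, ← ofReal_sub, norm_real, Real.norm_eq_abs, ← abs_of_pos (inv_pos.2 hΓ),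
    ← abs_mul, abs_of_pos (inv_pos.2 hΓ)]
  congr 1
  field_simp

theorem exists_exponential_sum (hα : 0 < α) (hh : 0 < step d ε) :
    ∃ w b : Fin (numTerms α d ε) → ℝ, (∀ j, 0 < w j ∧ 0 < b j) ∧
      ∀ ξ : ℝ, approx α d ε ξ = ((∑ j, w j * Real.exp (-(b j) * ξ) : ℝ) : ℂ) := by
  have := Real.Gamma_pos_of_pos (add_pos hα one_pos)
  set h := step d ε
  set nodes := Finset.Icc (-(Nminus d ε : ℤ)) (Nplus α d ε) with nodes_def
  have card_nodes : nodes.card = numTerms α d ε := by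
    rw [nodes_def, Int.card_Icc, numTerms]
    omega
  let e := nodes.equivFinOfCardEq card_nodes
  refine ⟨fun i => (Real.Gamma (α + 1))⁻¹ * h * Real.sigmoid ((e.symm i : ℤ) * h),
    fun i => softplus ((e.symm i : ℤ) * h) ^ (1 / α), fun i => ⟨?_, ?_⟩, fun ξ => ?_⟩
  · have := Real.sigmoid_pos ((e.symm i : ℤ) * h)
    positivity
  · exact Real.rpow_pos_of_pos (softplus_pos _) _
  · rw [approx_eq, ofReal_inj, Finset.mul_sum, Finset.mul_sum, ← Finset.sum_coe_sort nodes]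
    refine Fintype.sum_equiv e _ _ fun j => ?_
    simp only [gReal, Equiv.symm_apply_apply, neg_mul, mul_comm ξ]
    ring

theorem err_le_discretization_add_truncation (hα0 : 0 < α) (hα1 : α ≤ 1) (hd : 0 < d)
    (hdα : d / α < Real.pi / 4) (hε0 : 0 < ε) (hε1 : ε < 1) (hξ : 1 ≤ ξ) :
    err α d ε ξ ≤ (Real.Gamma (α + 1))⁻¹ * (stripNorm d (g α ξ) / (1 - ε) +
      step d ε / (Real.exp (step d ε) - 1) +
      step d ε / (Real.exp (tailRate α (step d ε) (Nplus α d ε)) - 1)) * ε := by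
  have hpi := Real.pi_pos
  have hd_lt : d < Real.pi / 2 := by
    rw [div_lt_iff₀ hα0] at hdα
    nlinarith
  have hβ := beta_pos hα0 hd.le hdα
  have hh := step_pos hd hε0 hε1
  have hn := Nplus_pos hd hβ hε0 hε1
  have hκ := tailRate_pos hα0 hh hn
  have discretization := abs_sub_trapezoidal_gReal_le hα0 (zero_lt_one.trans_le hξ) hd hd_lt
    (by linarith) hh
  have truncation := abs_tsum_gReal_sub_sum_le hα0 hα1 hξ hh hn (Nminus d ε)
  rw [err_eq hα0, mul_assoc]
  refine mul_le_mul_of_nonneg_left ?_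
    (inv_pos.2 (Real.Gamma_pos_of_pos (add_pos hα0 one_pos))).le
  rw [two_pi_mul_div_step hd, Real.exp_log (inv_pos.2 hε0)] at discretization
  set h := step d ε
  set κ := tailRate α h (Nplus α d ε)
  have exp_κ_pos : 0 < Real.exp κ - 1 := sub_pos.2 (Real.one_lt_exp_iff.2 hκ)
  have exp_h_pos : 0 < Real.exp h - 1 := sub_pos.2 (Real.one_lt_exp_iff.2 hh)
  refine (abs_sub_le _ (h * ∑' j : ℤ, gReal α ξ (j * h)) _).trans ?_
  rw [← mul_sub, abs_mul, abs_of_pos hh]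
  calc _ ≤ stripNorm d (g α ξ) / (ε⁻¹ - 1) +
        h * (ε / (Real.exp κ - 1) + ε / (Real.exp h - 1)) := by
        gcongr
        refine truncation.trans ?_
        gcongr
        · exact exp_neg_le_of_log_inv_le hε0
            (log_inv_le_Nplus_mul_step_rpow hα0 hd hβ hε0 hε1)
        · exact exp_neg_le_of_log_inv_le hε0 (log_inv_le_Nminus_mul_step hd hε0 hε1)
    _ = _ := by
        have : 1 - ε ≠ 0 := (sub_pos.2 hε1).ne'
        field_simp
        ring

theorem sq_le_exp_sub_one {x : ℝ} (hx : 0 ≤ x) : x ^ 2 ≤ Real.exp x - 1 := by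
  have taylor := Real.sum_le_exp_of_nonneg hx 4
  simp only [Finset.sum_range_succ, Finset.sum_range_zero, Nat.factorial] at taylor
  norm_num at taylor
  nlinarith [mul_nonneg hx (sq_nonneg (x - 3 / 2))]

theorem mul_rpow_le_exp_rpow_sub_one {p x : ℝ} (hp : 1 ≤ p) (hx : 0 ≤ x) :
    x * x ^ p ≤ Real.exp (x ^ p) - 1 := by
  have hxp : 0 ≤ x ^ p := Real.rpow_nonneg hx p
  obtain hx1 | hx1 := le_total x 1
  · exact (mul_le_of_le_one_left hxp hx1).trans (le_sub_iff_add_le.2 (Real.add_one_le_exp _))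
  · calc x * x ^ p ≤ x ^ p * x ^ p := by
          gcongr
          exact Real.self_le_rpow_of_one_le hx1 hp
      _ = (x ^ p) ^ 2 := (sq _).symm
      _ ≤ Real.exp (x ^ p) - 1 := sq_le_exp_sub_one hxp

theorem div_exp_rpow_sub_one_le {p x : ℝ} (hp : 1 ≤ p) (hx : 0 < x) :
    x / (Real.exp (x ^ p) - 1) ≤ 1 / x ^ p := by
  have hxp := Real.rpow_pos_of_pos hx p
  rw [div_le_div_iff₀ (sub_pos.2 (Real.one_lt_exp_iff.2 hxp)) hxp, one_mul]
  exact mul_rpow_le_exp_rpow_sub_one hp hx.le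

theorem err_le (hα0 : 0 < α) (hα1 : α ≤ 1) (hd : 0 < d) (hdα : d / α < Real.pi / 4)
    (hε0 : 0 < ε) (hε1 : ε < 1) (hξ : 1 ≤ ξ) :
    err α d ε ξ ≤ (Real.Gamma (α + 1))⁻¹ * (stripNorm d (g α ξ) / (1 - ε) + 1 / step d ε +
      1 / (beta α d * step d ε ^ (1 / α))) * ε := by
  have hh := step_pos hd hε0 hε1
  have hβ := beta_pos hα0 hd.le hdα
  have := Real.Gamma_pos_of_pos (add_pos hα0 one_pos)
  refine (err_le_discretization_add_truncation hα0 hα1 hd hdα hε0 hε1 hξ).trans ?_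
  set h := step d ε
  have hH : 0 < h ^ (1 / α) := Real.rpow_pos_of_pos hh _
  have left_tail_le : h / (Real.exp h - 1) ≤ 1 / h := by
    simpa using div_exp_rpow_sub_one_le le_rfl hh
  have right_tail_le : h / (Real.exp (tailRate α h (Nplus α d ε)) - 1) ≤
      1 / (beta α d * h ^ (1 / α)) :=
    calc h / (Real.exp (tailRate α h (Nplus α d ε)) - 1)
        ≤ h / (Real.exp (h ^ (1 / α)) - 1) := by
          gcongr
          · exact sub_pos.2 (Real.one_lt_exp_iff.2 hH)
          · exact rpow_le_tailRate hα0 hα1 hh.le (Nplus_pos hd hβ hε0 hε1)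
      _ ≤ 1 / h ^ (1 / α) := div_exp_rpow_sub_one_le (one_le_one_div hα0 hα1) hh
      _ ≤ 1 / (beta α d * h ^ (1 / α)) := by
          gcongr
          exact mul_le_of_le_one_left hH.le (beta_le_one α d)
  gcongr

end Parameters

section Gamma

variable {α : ℝ}

theorem two_rpow_sub_one_le_Gamma_add_one (hα0 : 0 < α) (hα1 : α ≤ 1) :
    2 ^ (α - 1) ≤ Real.Gamma (α + 1) := by
  obtain rfl | hα1 := hα1.eq_or_lt
  · norm_num [Real.Gamma_two]
  have hΓ := Real.Gamma_pos_of_pos (add_pos hα0 one_pos)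
  have hα2 : 0 < 2 - α := by linarith
  have Gamma_three : Real.Gamma 3 = 2 := by
    rw [← two_add_one_eq_three, Real.Gamma_add_one two_ne_zero, Real.Gamma_two, mul_one]
  -- `2` is the convex combination of `α + 1` and `3` with these weights.
  have log_convexity := Real.Gamma_mul_add_mul_le_rpow_Gamma_mul_rpow_Gamma (s := α + 1) (t := 3)
    (a := 1 / (2 - α)) (b := (1 - α) / (2 - α)) (by linarith) (by norm_num) (by positivity)
    (div_pos (by linarith) hα2) (by field_simp; ring)
  have node_eq : 1 / (2 - α) * (α + 1) + (1 - α) / (2 - α) * 3 = 2 := by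
    field_simp
    ring
  rw [node_eq, Real.Gamma_two, Gamma_three] at log_convexity
  have one_le : 1 ≤ Real.Gamma (α + 1) * 2 ^ (1 - α) := by
    refine (Real.one_le_rpow log_convexity hα2.le).trans_eq ?_
    rw [Real.mul_rpow (by positivity) (by positivity), ← Real.rpow_mul hΓ.le,
      ← Real.rpow_mul two_pos.le, div_mul_cancel₀ _ hα2.ne', div_mul_cancel₀ _ hα2.ne',
      Real.rpow_one]
  rwa [← neg_sub, Real.rpow_neg two_pos.le, inv_le_iff_one_le_mul₀ (by positivity)]

theorem one_sub_mul_log_two_le_Gamma_add_one (hα0 : 0 < α) (hα1 : α ≤ 1) :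
    1 - (1 - α) * Real.log 2 ≤ Real.Gamma (α + 1) := by
  refine le_trans ?_ (two_rpow_sub_one_le_Gamma_add_one hα0 hα1)
  rw [Real.rpow_def_of_pos two_pos]
  linarith [Real.add_one_le_exp (Real.log 2 * (α - 1))]

theorem le_Gamma_add_one (hα0 : 0 < α) (hα1 : α ≤ 1) : α ≤ Real.Gamma (α + 1) := by
  have hlog : Real.log 2 ≤ 1 := Real.log_two_lt_d9.le.trans (by norm_num)
  linarith [one_sub_mul_log_two_le_Gamma_add_one hα0 hα1,
    mul_le_of_le_one_right (sub_nonneg.2 hα1) hlog]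

theorem Gamma_add_one_le_one (hα0 : 0 ≤ α) (hα1 : α ≤ 1) : Real.Gamma (α + 1) ≤ 1 := by
  have convexity := Real.convexOn_Gamma.le_max_of_mem_Icc (x := 1) (y := 2) (z := α + 1)
    (Set.mem_Ioi.2 one_pos) (Set.mem_Ioi.2 two_pos) ⟨by linarith, by linarith⟩
  rwa [Real.Gamma_one, Real.Gamma_two, max_self] at convexity

end Gamma

section SmallTolerance

variable {α d ε ξ : ℝ}

theorem le_inv_rpow_inv (hα0 : 0 < α) (hα1 : α ≤ 1) :
    1 + (1 - α) + 2 * (1 - α) ^ 2 ≤ (1 / α) ^ (1 / α) := by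
  have hα := one_le_one_div hα0 hα1
  have bernoulli := one_add_mul_self_le_rpow_one_add (s := 1 / α - 1) (by linarith) hα
  rw [add_sub_cancel] at bernoulli
  have geometric : (1 - α) + (1 - α) ^ 2 ≤ 1 / α - 1 := by
    rw [le_sub_iff_add_le, le_div_iff₀ hα0]
    linarith [pow_nonneg (sub_nonneg.2 hα1) 3]
  nlinarith

theorem exp_neg_pi_sq_div_four_lt : Real.exp (-(Real.pi ^ 2 / 4)) < 1 / 11 := by
  have hpi : 2.46 < Real.pi ^ 2 / 4 := by nlinarith [Real.pi_gt_d2]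
  have taylor : (11 : ℝ) < Real.exp 2.46 :=
    lt_of_lt_of_le (by norm_num [Finset.sum_range_succ, Nat.factorial])
      (Real.sum_le_exp_of_nonneg (by norm_num) 8)
  rw [Real.exp_neg, ← one_div]
  exact one_div_lt_one_div_of_lt (by norm_num) (taylor.trans (Real.exp_lt_exp.2 hpi))

theorem pi_sq_div_four_lt_log_inv (hε0 : 0 < ε) (hε : ε < Real.exp (-(Real.pi ^ 2 / 4))) :
    Real.pi ^ 2 / 4 < Real.log ε⁻¹ := by
  rwa [Real.log_inv, lt_neg, Real.log_lt_iff_lt_exp hε0]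

theorem one_le_log_inv (hε0 : 0 < ε) (hε : ε ≤ 1 / 11) : 1 ≤ Real.log ε⁻¹ := by
  rw [Real.le_log_iff_exp_le (by positivity), le_inv_comm₀ (Real.exp_pos 1) hε0]
  refine hε.trans ?_
  rw [one_div]
  exact inv_anti₀ (Real.exp_pos 1) (Real.exp_one_lt_d9.le.trans (by norm_num))

theorem step_lt (hα : 0 < α) (hd : d ≤ Real.pi * α / 8) (hε0 : 0 < ε)
    (hε : ε < Real.exp (-(Real.pi ^ 2 / 4))) : step d ε < α := by
  have hL := pi_sq_div_four_lt_log_inv hε0 hε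
  rw [step, div_lt_iff₀ (lt_trans (by positivity) hL)]
  calc 2 * Real.pi * d ≤ 2 * Real.pi * (Real.pi * α / 8) := by gcongr
    _ = α * (Real.pi ^ 2 / 4) := by ring
    _ < α * Real.log ε⁻¹ := by gcongr

theorem div_exp_sub_one_le {x : ℝ} (hx : 0 < x) : x / (Real.exp x - 1) ≤ 1 / (1 + x / 2) := by
  rw [div_le_div_iff₀ (sub_pos.2 (Real.one_lt_exp_iff.2 hx)) (by positivity)]
  linarith [Real.quadratic_le_exp_of_nonneg hx.le]

theorem one_le_Nplus_mul_step (hα : 0 < α) (hd : 0 < d) (hβ : 0 < beta α d) (hε0 : 0 < ε)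
    (hε : ε ≤ 1 / 11) : 1 ≤ Nplus α d ε * step d ε := by
  have hε1 : ε < 1 := hε.trans_lt (by norm_num)
  have one_le_rpow := (one_le_log_inv hε0 hε).trans
    (log_inv_le_Nplus_mul_step_rpow hα hd hβ hε0 hε1)
  contrapose! one_le_rpow
  exact Real.rpow_lt_one (mul_nonneg (Nat.cast_nonneg _) (step_pos hd hε0 hε1).le) one_le_rpow
    (by positivity)

theorem stripNorm_nonneg (d : ℝ) (f : ℂ → ℂ) : 0 ≤ stripNorm d f :=
  add_nonneg (integral_nonneg fun _ => norm_nonneg _) (integral_nonneg fun _ => norm_nonneg _)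

theorem err_le_of_le_one_div_eleven (hα0 : 0 < α) (hα1 : α ≤ 1) (hd : 0 < d)
    (hdα : d / α < Real.pi / 4) (hε0 : 0 < ε) (hε : ε ≤ 1 / 11) (hξ : 1 ≤ ξ) :
    err α d ε ξ ≤ (Real.Gamma (α + 1))⁻¹ *
      (1.1 * stripNorm d (g α ξ) + 1 / (1 + step d ε / 2) + α) * ε := by
  have hε1 : ε < 1 := hε.trans_lt (by norm_num)
  have hh := step_pos hd hε0 hε1
  have := Real.Gamma_pos_of_pos (add_pos hα0 one_pos)
  have hβ := beta_pos hα0 hd.le hdα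
  have hn := Nplus_pos hd hβ hε0 hε1
  have hκ := tailRate_pos hα0 hh hn
  refine (err_le_discretization_add_truncation hα0 hα1 hd hdα hε0 hε1 hξ).trans ?_
  have discretization_le : stripNorm d (g α ξ) / (1 - ε) ≤ 1.1 * stripNorm d (g α ξ) := by
    rw [div_le_iff₀ (sub_pos.2 hε1)]
    nlinarith [stripNorm_nonneg d (g α ξ)]
  have left_tail_le := div_exp_sub_one_le hh
  have right_tail_le :
      step d ε / (Real.exp (tailRate α (step d ε) (Nplus α d ε)) - 1) ≤ α := by
    rw [div_le_iff₀ (sub_pos.2 (Real.one_lt_exp_iff.2 hκ))]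
    refine (step_le_mul_tailRate hα0 hα1 hn (one_le_Nplus_mul_step hα0 hd hβ hε0 hε)).trans ?_
    gcongr
    exact le_sub_iff_add_le.2 (Real.add_one_le_exp _)
  gcongr

theorem inv_rpow_inv_le_of_step_le (hα : 0 < α) (hd : 0 < d) (hdα : d / α < Real.pi / 4)
    (hh0 : 0 < step d ε) (hh : step d ε ≤ α) :
    (1 / α) ^ (1 / α) ≤ 1 / (beta α d * step d ε ^ (1 / α)) := by
  have hβ := beta_pos hα hd.le hdα
  rw [Real.div_rpow zero_le_one hα.le, Real.one_rpow]
  gcongr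
  calc beta α d * step d ε ^ (1 / α) ≤ step d ε ^ (1 / α) :=
        mul_le_of_le_one_left (by positivity) (beta_le_one α d)
    _ ≤ α ^ (1 / α) := by gcongr

theorem one_div_one_add_half_le_Gamma_mul (hα0 : 0 < α) (hα1 : α ≤ 1) {h : ℝ} (hh0 : 0 < h)
    (hh : h < α) : 1 / (1 + h / 2) ≤ Real.Gamma (α + 1) * (1 / h - 1 / 3) := by
  have : h < 1 := hh.trans_le hα1
  have gap_nonneg : 0 ≤ 1 / h - 1 / 3 :=
    sub_nonneg.2 (one_div_le_one_div_of_le hh0 (by linarith))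
  calc 1 / (1 + h / 2) ≤ 1 - h / 3 := by
        rw [div_le_iff₀ (by positivity)]
        nlinarith
    _ = h * (1 / h - 1 / 3) := by field_simp
    _ ≤ Real.Gamma (α + 1) * (1 / h - 1 / 3) := by
        gcongr
        exact hh.le.trans (le_Gamma_add_one hα0 hα1)

theorem err_le_stripNorm_of_small (hα0 : 0 < α) (hα1 : α ≤ 1) (hd0 : 0 < d)
    (hd : d ≤ Real.pi * α / 8) (hε0 : 0 < ε) (hε : ε < Real.exp (-(Real.pi ^ 2 / 4)))
    (hξ : 1 ≤ ξ) :
    err α d ε ξ ≤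
      (stripNorm d (g α ξ) + 1 / step d ε + 1 / (beta α d * step d ε ^ (1 / α))) * ε := by
  have hε11 := (hε.trans exp_neg_pi_sq_div_four_lt).le
  have hh := step_pos hd0 hε0 (hε11.trans_lt (by norm_num))
  have hdα := div_lt_pi_div_four hα0 hd
  have hΓ := Real.Gamma_pos_of_pos (add_pos hα0 one_pos)
  have hΓ1 := Gamma_add_one_le_one hα0.le hα1
  have h_lt := step_lt hα0 hd hε0 hε
  refine (err_le_of_le_one_div_eleven hα0 hα1 hd0 hdα hε0 hε11 hξ).trans ?_
  refine mul_le_mul_of_nonneg_right ((inv_mul_le_iff₀ hΓ).2 ?_) hε0.le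
  have left_tail := one_div_one_add_half_le_Gamma_mul hα0 hα1 hh h_lt
  have inv_le := inv_rpow_inv_le_of_step_le hα0 hd0 hdα hh h_lt.le
  have norm_le := mul_le_mul_of_nonneg_right (stripNorm_g_le hα0 hα1 hd0.le hd hξ)
    (show 0 ≤ 1.1 - Real.Gamma (α + 1) by linarith)
  have Gamma_ge : 1 - (1 - α) * 0.6932 ≤ Real.Gamma (α + 1) := by
    nlinarith [one_sub_mul_log_two_le_Gamma_add_one hα0 hα1, Real.log_two_lt_d9]
  have le_right_term :
      2.54 * (1.1 - Real.Gamma (α + 1)) + 1 - 1 / 3 ≤ 1 / (beta α d * step d ε ^ (1 / α)) := by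
    refine le_trans ?_ ((le_inv_rpow_inv hα0 hα1).trans inv_le)
    nlinarith [sq_nonneg ((1 - α) - 0.19)]
  linarith [mul_le_mul_of_nonneg_left le_right_term hΓ.le, le_Gamma_add_one hα0 hα1]

theorem err_le_const_mul (hα0 : 0 < α) (hα1 : α ≤ 1) (hd0 : 0 < d)
    (hd : d ≤ Real.pi * α / 8) (hε0 : 0 < ε) (hε : ε ≤ 1 / 11) (hξ : 1 ≤ ξ) :
    err α d ε ξ ≤ (3.8 + 1 / α) * ε := by
  have hh := step_pos hd0 hε0 (hε.trans_lt (by norm_num))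
  have hΓ := Real.Gamma_pos_of_pos (add_pos hα0 one_pos)
  have α_le_Γ := le_Gamma_add_one hα0 hα1
  refine (err_le_of_le_one_div_eleven hα0 hα1 hd0 (div_lt_pi_div_four hα0 hd) hε0 hε hξ).trans ?_
  refine mul_le_mul_of_nonneg_right ((inv_mul_le_iff₀ hΓ).2 ?_) hε0.le
  have left_tail_le_one : 1 / (1 + step d ε / 2) ≤ 1 := by
    rw [div_le_one (by positivity)]
    linarith
  have one_le : 1 ≤ Real.Gamma (α + 1) * (1 / α) := by
    rwa [mul_one_div, one_le_div hα0]
  linarith [stripNorm_g_le hα0 hα1 hd0.le hd hξ]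

theorem inv_le_log_inv_rpow (hα0 : 0 < α) (hα1 : α ≤ 1)
    (hε : Real.pi ^ 2 / 4 ≤ Real.log ε⁻¹) :
    1 / α ≤ (4 * Real.log ε⁻¹ / (Real.pi ^ 2 * α)) ^ (1 / α) := by
  have inv_le : 1 / α ≤ 4 * Real.log ε⁻¹ / (Real.pi ^ 2 * α) := by
    rw [div_le_div_iff₀ hα0 (by positivity)]
    nlinarith
  have hα := one_le_one_div hα0 hα1
  exact inv_le.trans (Real.self_le_rpow_of_one_le (hα.trans inv_le) hα)

theorem err_le_log_of_small (hα0 : 0 < α) (hα1 : α ≤ 1) (hd0 : 0 < d)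
    (hd : d ≤ Real.pi * α / 8) (hε0 : 0 < ε) (hε : ε < Real.exp (-(Real.pi ^ 2 / 4)))
    (hξ : 1 ≤ ξ) :
    err α d ε ξ ≤ 2 * (1 + Real.log 2 + Real.Gamma (α + 1) / Real.cos (Real.pi / 8) ^ α
      + (Real.cos (Real.pi / 4))⁻¹ * (4 * Real.log ε⁻¹ / (Real.pi ^ 2 * α)) ^ (1 / α)) * ε := by
  have hpi := Real.pi_pos
  have hε11 := (hε.trans exp_neg_pi_sq_div_four_lt).le
  refine (err_le_const_mul hα0 hα1 hd0 hd hε0 hε11 hξ).trans ?_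
  refine mul_le_mul_of_nonneg_right ?_ hε0.le
  have inv_α_le := inv_le_log_inv_rpow hα0 hα1 (pi_sq_div_four_lt_log_inv hε0 hε).le
  have one_le_inv_cos : 1 ≤ (Real.cos (Real.pi / 4))⁻¹ :=
    (one_le_inv₀ (Real.cos_pos_of_mem_Ioo ⟨by linarith, by linarith⟩)).2 (Real.cos_le_one _)
  have le_inv_cos_mul := le_mul_of_one_le_left
    ((one_div_pos.2 hα0).le.trans inv_α_le) one_le_inv_cos
  have Gamma_term_pos : 0 < Real.Gamma (α + 1) / Real.cos (Real.pi / 8) ^ α :=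
    div_pos (Real.Gamma_pos_of_pos (add_pos hα0 one_pos))
      (Real.rpow_pos_of_pos (Real.cos_pos_of_mem_Ioo ⟨by linarith, by linarith⟩) _)
  linarith [Real.log_two_gt_d9, one_le_one_div hα0 hα1]

end SmallTolerance

section NumTerms

variable {α d ε : ℝ}

theorem mul_two_pi_mul_div_step_sq (hd : 0 < d) (ε : ℝ) :
    2 * Real.pi * d * (2 * Real.pi * d / step d ε ^ 2) = Real.log ε⁻¹ ^ 2 := by
  rw [← two_pi_mul_div_step hd]
  ring

theorem mul_Nplus_arg_eq (hα : 0 < α) (hd : 0 < d) (hβ : 0 ≤ beta α d) (hh : 0 < step d ε) :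
    2 * Real.pi * d * (2 * Real.pi * d * step d ε ^ (-((α + 1) / α)) / beta α d) ^ α =
      (beta α d ^ α)⁻¹ * Real.log ε⁻¹ ^ (1 + α) := by
  have hD : 0 < 2 * Real.pi * d := by positivity
  have exponent_eq : -((α + 1) / α) * α = -(1 + α) := by
    field_simp
    ring
  rw [Real.div_rpow (by positivity) hβ, Real.mul_rpow hD.le (by positivity),
    ← Real.rpow_mul hh.le, exponent_eq, Real.rpow_neg hh.le, ← two_pi_mul_div_step hd,
    Real.div_rpow hD.le hh.le, Real.rpow_add hD, Real.rpow_one]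
  ring

theorem sq_log_inv_le_mul_numTerms (α : ℝ) (hd : 0 < d) (ε : ℝ) :
    Real.log ε⁻¹ ^ 2 ≤ 2 * Real.pi * d * numTerms α d ε := by
  rw [← mul_two_pi_mul_div_step_sq hd]
  gcongr
  refine (Nat.le_ceil _).trans ?_
  rw [numTerms, add_assoc]
  exact Nat.cast_le.2 (Nat.le_add_right _ _)

theorem mul_numTerms_le (hα : 0 < α) (hd : 0 < d) (hβ : 0 ≤ beta α d) (hh : 0 < step d ε) :
    2 * Real.pi * d * numTerms α d ε ≤
      Real.log ε⁻¹ ^ 2 + (beta α d ^ α)⁻¹ * Real.log ε⁻¹ ^ (1 + α) + 2 * Real.pi * d * 3 := by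
  rw [← mul_two_pi_mul_div_step_sq hd, ← mul_Nplus_arg_eq hα hd hβ hh, ← mul_add, ← mul_add]
  gcongr
  have Nminus_lt : (Nminus d ε : ℝ) < 2 * Real.pi * d / step d ε ^ 2 + 1 :=
    Nat.ceil_lt_add_one (by positivity)
  have Nplus_lt : (Nplus α d ε : ℝ) <
      (2 * Real.pi * d * step d ε ^ (-((α + 1) / α)) / beta α d) ^ α + 1 :=
    Nat.ceil_lt_add_one (by positivity)
  rw [numTerms]
  push_cast
  linarith

theorem tendsto_sq_add_rpow_add_const_div_sq (hα : α < 1) (b c : ℝ) :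
    Tendsto (fun x : ℝ => (x ^ 2 + b * x ^ (1 + α) + c) / x ^ 2) atTop (𝓝 1) := by
  have power_vanishes := (tendsto_rpow_neg_atTop (sub_pos.2 hα)).const_mul b
  have const_vanishes := (tendsto_pow_atTop (α := ℝ) two_ne_zero).const_div_atTop c
  have limit := (power_vanishes.const_add 1).add const_vanishes
  rw [mul_zero, add_zero, add_zero] at limit
  refine limit.congr' ?_
  filter_upwards [eventually_gt_atTop 0] with x hx
  have rpow_eq : x ^ (1 + α) = x ^ (-(1 - α)) * x ^ 2 := by
    rw [← Real.rpow_natCast, ← Real.rpow_add hx]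
    push_cast
    ring_nf
  rw [rpow_eq]
  field_simp

theorem tendsto_log_inv : Tendsto (fun ε : ℝ => Real.log ε⁻¹) (𝓝[>] 0) atTop :=
  Real.tendsto_log_atTop.comp tendsto_inv_nhdsGT_zero

theorem tendsto_mul_numTerms_div_sq_log (hα0 : 0 < α) (hα1 : α < 1) (hd : 0 < d)
    (hβ : 0 ≤ beta α d) :
    Tendsto (fun ε => 2 * Real.pi * d * numTerms α d ε / Real.log ε⁻¹ ^ 2) (𝓝[>] 0) (𝓝 1) := by
  have eventually_small : ∀ᶠ ε : ℝ in 𝓝[>] 0, 0 < ε ∧ ε < 1 := Ioo_mem_nhdsGT one_pos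
  have upper_limit := (tendsto_sq_add_rpow_add_const_div_sq hα1 (beta α d ^ α)⁻¹
    (2 * Real.pi * d * 3)).comp tendsto_log_inv
  refine tendsto_of_tendsto_of_tendsto_of_le_of_le' tendsto_const_nhds upper_limit ?_ ?_
  · filter_upwards [eventually_small] with ε ⟨hε0, hε1⟩
    rw [one_le_div (pow_pos (log_inv_pos hε0 hε1) 2)]
    exact sq_log_inv_le_mul_numTerms α hd ε
  · filter_upwards [eventually_small] with ε ⟨hε0, hε1⟩
    exact div_le_div_of_nonneg_right (mul_numTerms_le hα0 hd hβ (step_pos hd hε0 hε1)) (sq_nonneg _)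

theorem isEquivalent_numTerms (hα0 : 0 < α) (hα1 : α < 1) (hd : 0 < d) (hβ : 0 ≤ beta α d) :
    (fun ε => (numTerms α d ε : ℝ)) ~[𝓝[>] 0]
      fun ε => Real.log ε⁻¹ ^ 2 / (2 * Real.pi * d) := by
  refine isEquivalent_of_tendsto_one
    ((tendsto_mul_numTerms_div_sq_log hα0 hα1 hd hβ).congr fun ε => ?_)
  rw [Pi.div_apply, div_div_eq_mul_div, mul_comm]

theorem isEquivalent_log_inv (hα0 : 0 < α) (hα1 : α < 1) (hd : 0 < d) (hβ : 0 ≤ beta α d) :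
    (fun ε => Real.log ε⁻¹) ~[𝓝[>] 0] fun ε => √(2 * Real.pi * d * numTerms α d ε) := by
  have limit := (tendsto_mul_numTerms_div_sq_log hα0 hα1 hd hβ).sqrt.inv₀ (by simp)
  rw [Real.sqrt_one, inv_one] at limit
  refine isEquivalent_of_tendsto_one (limit.congr' ?_)
  filter_upwards [Ioo_mem_nhdsGT one_pos] with ε ⟨hε0, hε1⟩
  rw [Real.sqrt_div' _ (by positivity), Real.sqrt_sq (log_inv_pos hε0 hε1).le, inv_div,
    Pi.div_apply]

theorem log_inv_le_sqrt_mul_numTerms (α : ℝ) (hd : 0 < d) (ε : ℝ) :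
    Real.log ε⁻¹ ≤ √(2 * Real.pi * d * numTerms α d ε) :=
  Real.le_sqrt_of_sq_le (sq_log_inv_le_mul_numTerms α hd ε)

theorem log_inv_rpow_le (hα : 0 ≤ α) (hd : 0 < d) (hε : 0 ≤ Real.log ε⁻¹) :
    Real.log ε⁻¹ ^ α ≤ (2 * Real.pi * d) ^ (α / 2) * numTerms α d ε ^ (α / 2) := by
  refine (Real.rpow_le_rpow hε (log_inv_le_sqrt_mul_numTerms α hd ε) hα).trans_eq ?_
  rw [Real.sqrt_eq_rpow, ← Real.rpow_mul (by positivity), one_div_mul_eq_div,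
    Real.mul_rpow (by positivity) (Nat.cast_nonneg _)]

theorem sqrt_mul_numTerms_le (hα : 0 < α) (hd : 0 < d) (hβ : 0 < beta α d)
    (hh : 0 < step d ε) (hε : 1 ≤ Real.log ε⁻¹) :
    √(2 * Real.pi * d * numTerms α d ε) ≤
      Real.log ε⁻¹ + ((beta α d ^ α)⁻¹ + 2 * Real.pi * d * 3) / 2 * Real.log ε⁻¹ ^ α := by
  refine Real.sqrt_le_iff.2 ⟨by positivity, (mul_numTerms_le hα hd hβ.le hh).trans ?_⟩
  set L := Real.log ε⁻¹
  set b := (beta α d ^ α)⁻¹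
  set c := 2 * Real.pi * d * 3
  have rpow_eq : L ^ (1 + α) = L * L ^ α := by rw [Real.rpow_add (by positivity), Real.rpow_one]
  calc L ^ 2 + b * L ^ (1 + α) + c
      ≤ L ^ 2 + b * L ^ (1 + α) + c * L ^ (1 + α) := by
        gcongr
        exact le_mul_of_one_le_right (by positivity) (Real.one_le_rpow hε (by positivity))
    _ ≤ L ^ 2 + b * L ^ (1 + α) + c * L ^ (1 + α) + ((b + c) / 2 * L ^ α) ^ 2 :=
        le_add_of_nonneg_right (sq_nonneg _)
    _ = (L + (b + c) / 2 * L ^ α) ^ 2 := by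
        rw [rpow_eq]
        ring

/-- A bound, uniform in `ε`, for `(√(2πdN) - log (1/ε)) / N ^ (α / 2)`: the accuracy lost by
writing `ε` as `exp (-√(2πdN))`. -/
noncomputable def accuracyLoss (α d : ℝ) : ℝ :=
  ((beta α d ^ α)⁻¹ + 2 * Real.pi * d * 3) / 2 * (2 * Real.pi * d) ^ (α / 2)

theorem accuracyLoss_pos (hd : 0 < d) (hβ : 0 < beta α d) : 0 < accuracyLoss α d := by
  unfold accuracyLoss
  positivity

theorem sqrt_mul_numTerms_sub_le_log_inv (hα : 0 < α) (hd : 0 < d) (hβ : 0 < beta α d)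
    (hh : 0 < step d ε) (hε : 1 ≤ Real.log ε⁻¹) :
    √(2 * Real.pi * d * numTerms α d ε) - accuracyLoss α d * numTerms α d ε ^ (α / 2) ≤
      Real.log ε⁻¹ := by
  rw [sub_le_iff_le_add, accuracyLoss,
    mul_assoc (((beta α d ^ α)⁻¹ + 2 * Real.pi * d * 3) / 2)]
  refine (sqrt_mul_numTerms_le hα hd hβ hh hε).trans ?_
  gcongr
  exact log_inv_rpow_le hα.le hd (zero_le_one.trans hε)

theorem exists_accuracy_constant (hα0 : 0 < α) (hα1 : α ≤ 1) (hd0 : 0 < d)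
    (hd : d ≤ Real.pi * α / 8) :
    ∃ C : ℝ, 0 < C ∧ ∀ ε : ℝ, 0 < ε → ε ≤ 1 / 11 →
      Real.exp (-√(2 * Real.pi * d * numTerms α d ε)) ≤ ε ∧
      ε ≤ Real.exp (-√(2 * Real.pi * d * numTerms α d ε)
        + C * (numTerms α d ε : ℝ) ^ (α / 2)) ∧
      ∀ ξ : ℝ, 1 ≤ ξ → err α d ε ξ ≤
        C * Real.exp (-√(2 * Real.pi * d * numTerms α d ε)
          + C * (numTerms α d ε : ℝ) ^ (α / 2)) := by
  have hβ := beta_pos hα0 hd0.le (div_lt_pi_div_four hα0 hd)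
  have loss_pos := accuracyLoss_pos hd0 hβ
  have := one_div_pos.2 hα0
  refine ⟨accuracyLoss α d + (3.8 + 1 / α), by positivity, fun ε hε0 hε => ?_⟩
  set C := accuracyLoss α d + (3.8 + 1 / α)
  have hh := step_pos hd0 hε0 (hε.trans_lt (by norm_num))
  have ε_le : ε ≤ Real.exp (-√(2 * Real.pi * d * numTerms α d ε)
      + C * (numTerms α d ε : ℝ) ^ (α / 2)) := by
    have loss_le : accuracyLoss α d * (numTerms α d ε : ℝ) ^ (α / 2) ≤
        C * (numTerms α d ε : ℝ) ^ (α / 2) := by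
      gcongr
      exact le_add_of_nonneg_right (by positivity)
    rw [← Real.log_le_iff_le_exp hε0, ← neg_neg (Real.log ε), ← Real.log_inv]
    linarith [sqrt_mul_numTerms_sub_le_log_inv hα0 hd0 hβ hh (one_le_log_inv hε0 hε)]
  refine ⟨exp_neg_le_of_log_inv_le hε0 (log_inv_le_sqrt_mul_numTerms α hd0 ε), ε_le,
    fun ξ hξ => (err_le_const_mul hα0 hα1 hd0 hd hε0 hε hξ).trans ?_⟩
  gcongr
  exact le_add_of_nonneg_left loss_pos.le

end NumTerms

end SincExpSum

open SincExpSum in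
theorem theorem2p6 (α d : ℝ) (hα0 : 0 < α) (hα1 : α < 1)
    (hd0 : 0 < d) (hd : d ≤ Real.pi * α / 8) :
    Real.cos (Real.pi / 4) ≤ beta α d ∧
    -- the boundary norm of `g` is finite
    (∀ ξ : ℝ, 1 ≤ ξ → StripBoundaryIntegrable d (g α ξ)) ∧
    -- the approximant is an exponential sum with `N = N_- + N_+ + 1` terms
    (∀ ε : ℝ, 0 < ε → ε < 1 → ∃ w b : Fin (numTerms α d ε) → ℝ,
      (∀ j, 0 < w j ∧ 0 < b j) ∧
      ∀ ξ : ℝ, 1 ≤ ξ → approx α d ε ξ = ((∑ j, w j * Real.exp (-(b j) * ξ) : ℝ) : ℂ)) ∧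
    -- error bound for every `ε ∈ (0, 1)`
    (∀ ε : ℝ, 0 < ε → ε < 1 → ∀ ξ : ℝ, 1 ≤ ξ →
      err α d ε ξ ≤ (Real.Gamma (α + 1))⁻¹ *
        (stripNorm d (g α ξ) / (1 - ε) + 1 / step d ε
          + 1 / (beta α d * step d ε ^ (1 / α))) * ε) ∧
    -- error bounds for `ε < exp(-π²/4)`
    (∀ ε : ℝ, 0 < ε → ε < Real.exp (-(Real.pi ^ 2 / 4)) → ∀ ξ : ℝ, 1 ≤ ξ →
      err α d ε ξ ≤
        (stripNorm d (g α ξ) + 1 / step d ε + 1 / (beta α d * step d ε ^ (1 / α))) * ε ∧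
      err α d ε ξ ≤
        2 * (1 + Real.log 2 + Real.Gamma (α + 1) / Real.cos (Real.pi / 8) ^ α
          + (Real.cos (Real.pi / 4))⁻¹
            * (4 * Real.log ε⁻¹ / (Real.pi ^ 2 * α)) ^ (1 / α)) * ε) ∧
    -- asymptotics of the number of terms, as `ε → 0+`
    Asymptotics.IsEquivalent (nhdsWithin (0 : ℝ) (Set.Ioi 0))
      (fun ε => (numTerms α d ε : ℝ)) (fun ε => Real.log ε⁻¹ ^ 2 / (2 * Real.pi * d)) ∧
    Asymptotics.IsEquivalent (nhdsWithin (0 : ℝ) (Set.Ioi 0))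
      (fun ε => Real.log ε⁻¹) (fun ε => Real.sqrt (2 * Real.pi * d * numTerms α d ε)) ∧
    -- accuracy in terms of the number of terms, uniformly in `ξ`
    (∃ C : ℝ, 0 < C ∧ ∀ ε : ℝ, 0 < ε → ε < Real.exp (-(Real.pi ^ 2 / 4)) →
      Real.exp (-Real.sqrt (2 * Real.pi * d * numTerms α d ε)) ≤ ε ∧
      ε ≤ Real.exp (-Real.sqrt (2 * Real.pi * d * numTerms α d ε)
        + C * (numTerms α d ε : ℝ) ^ (α / 2)) ∧
      ∀ ξ : ℝ, 1 ≤ ξ → err α d ε ξ ≤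
        C * Real.exp (-Real.sqrt (2 * Real.pi * d * numTerms α d ε)
          + C * (numTerms α d ε : ℝ) ^ (α / 2))) := by
  have := Real.pi_pos
  have hdα := div_lt_pi_div_four hα0 hd
  have hβ := beta_pos hα0 hd0.le hdα
  have hε11 {ε : ℝ} (hε : ε < Real.exp (-(Real.pi ^ 2 / 4))) : ε ≤ 1 / 11 :=
    (hε.trans exp_neg_pi_sq_div_four_lt).le
  obtain ⟨C, hC, accuracy⟩ := exists_accuracy_constant hα0 hα1.le hd0 hd
  refine ⟨cos_pi_div_four_le_beta hα0 hd0.le hd, fun ξ hξ => ?finite_norm,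
    fun ε hε0 hε1 => ?exponential_sum,
    fun ε hε0 hε1 ξ hξ => err_le hα0 hα1.le hd0 hdα hε0 hε1 hξ,
    fun ε hε0 hε ξ hξ => ⟨err_le_stripNorm_of_small hα0 hα1.le hd0 hd hε0 hε hξ,
      err_le_log_of_small hα0 hα1.le hd0 hd hε0 hε hξ⟩,
    isEquivalent_numTerms hα0 hα1 hd0 hβ.le, isEquivalent_log_inv hα0 hα1 hd0 hβ.le,
    C, hC, fun ε hε0 hε => accuracy ε hε0 (hε11 hε)⟩
  case finite_norm =>
    have hd_lt : d < Real.pi / 2 := by nlinarith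
    exact (stripDominated_g hα0 (zero_lt_one.trans_le hξ) hd0.le hd_lt
      (by linarith)).stripBoundaryIntegrable hd0.le
  case exponential_sum =>
    obtain ⟨w, b, hpos, hsum⟩ := exists_exponential_sum hα0 (step_pos hd0 hε0 hε1)
    exact ⟨w, b, hpos, fun ξ _ => hsum ξ⟩
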